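/- Let ${\mathcal S}_\infty$ be the group of permutations of $\{1,2,3,\dots\}$ that fix all but finitely many letters, let $\ell(w)$ be the number of inversions of $w$, and let ${\mathfrak S}_w\in\mathbb Z[x_1,x_2,\dots]$ be the Schubert polynomial of $w\in{\mathcal S}_\infty$. For $k\ge 0$, the $k$-Bruhat order $\le_k$ is the partial order on ${\mathcal S}_\infty$ whose covers are $u\lessdot_k u(a\,b)$ with $a\le k<b$ and $\ell(u(a\,b))=\ell(u)+1$. For a partition $\lambda$ with at most $k$ parts, let $v(\lambda,k)\in{\mathcal S}_\infty$ be the Grassmannian permutation of shape $\lambda$ with descent at $k$: $v(i)=i+\lambda_{k+1-i}$ for $i\le k$, and $v(k+1)<v(k+2)<\cdots$ (so that ${\mathfrak S}_{v(\lambda,k)}$ is the Schur polynomial $S_\lambda(x_1,\dots,x_k)$). For $u\in{\mathcal S}_\infty$ the integers $c^w_{u\,v(\lambda,k)}$ are defined by the expansion $$ {\mathfrak S}_u\,{\mathfrak S}_{v(\lambda,k)}=\sum_{w\in{\mathcal S}_\infty} c^w_{u\,v(\lambda,k)}\,{\mathfrak S}_w $$ (a finite sum), which exists and is unique. Then: (1)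 $c^w_{u\,v(\lambda,k)}=0$ unless $u\le_k w$. (2) If $u\le_k w$, then $c^w_{u\,v(\lambda,k)}$ depends only on $\lambda$ and $wu^{-1}$; that is, if $u\le_k w$, $u'\le_{k'}w'$ and $wu^{-1}=w'(u')^{-1}$, and if $\lambda$ has at most $\min(k,k')$ parts, then $c^w_{u\,v(\lambda,k)}=c^{w'}_{u'\,v(\lambda,k')}$. -/

import Mathlib

namespace SchubertStructure

/-- The group `S_∞` of permutations with finite support. The letters `1, 2, 3, …` are indexed
from `0`, so that the letter `i + 1` is represented by the natural number `i`. -/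
def SInf : Subgroup (Equiv.Perm ℕ) where
  carrier := {σ | {i | σ i ≠ i}.Finite}
  one_mem' := by simp
  mul_mem' := by
    intro σ τ hσ hτ
    refine (Set.Finite.union hσ hτ).subset ?_
    intro i hi
    by_contra h
    simp only [Set.mem_union, Set.mem_ofPred_eq, not_or, not_not] at h
    exact hi (by rw [Equiv.Perm.mul_apply, h.2, h.1])
  inv_mem' := by
    intro σ hσ
    refine Set.Finite.subset hσ ?_
    intro i hi h
    exact hi (by rw [Equiv.Perm.inv_eq_iff_eq]; exact h.symm)

/-- The length of a permutation: its number of inversions. -/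
noncomputable def length (w : SInf) : ℕ :=
  {p : ℕ × ℕ | p.1 < p.2 ∧ w.1 p.2 < w.1 p.1}.ncard

/-- The cover relation of the `k`-Bruhat order: `w = u (a b)` with `a ≤ k < b` (in letters counted
from `1`; here positions are counted from `0`) and `ℓ(w) = ℓ(u) + 1`. -/
def KBruhatCover (k : ℕ) (u w : SInf) : Prop :=
  ∃ a b : ℕ, a < k ∧ k ≤ b ∧ (w : Equiv.Perm ℕ) = (u : Equiv.Perm ℕ) * Equiv.swap a b ∧
    length w = length u + 1

/-- The `k`-Bruhat order `u ≤_k w`: there is a (possibly empty) saturated chain from `u` to `w`. -/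
def KBruhatLE (k : ℕ) (u w : SInf) : Prop :=
  Relation.ReflTransGen (KBruhatCover k) u w

/-- The ring `ℤ[x₁, x₂, …]`; the variable `x_{i+1}` is `X i`. -/
abbrev Poly : Type := MvPolynomial ℕ ℤ

theorem exists_divDiff (i : ℕ) (f : Poly) :
    ∃ g : Poly, (MvPolynomial.X i - MvPolynomial.X (i + 1)) * g =
      f - MvPolynomial.rename (Equiv.swap i (i + 1)) f := by
  induction f using MvPolynomial.induction_on with
  | C a => exact ⟨0, by simp⟩
  | add p q hp hq =>
    obtain ⟨g, hg⟩ := hp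
    obtain ⟨h, hh⟩ := hq
    exact ⟨g + h, by rw [mul_add, hg, hh, map_add]; ring⟩
  | mul_X p j hp =>
    obtain ⟨g, hg⟩ := hp
    have key : ∃ t : Poly, (MvPolynomial.X i - MvPolynomial.X (i + 1)) * t =
        MvPolynomial.X j - MvPolynomial.X (Equiv.swap i (i + 1) j) := by
      by_cases h1 : j = i
      · subst h1; exact ⟨1, by simp⟩
      by_cases h2 : j = i + 1
      · subst h2; exact ⟨-1, by simp⟩
      · exact ⟨0, by rw [Equiv.swap_apply_of_ne_of_ne h1 h2]; simp⟩
    obtain ⟨t, ht⟩ := key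
    refine ⟨g * MvPolynomial.X j + MvPolynomial.rename (Equiv.swap i (i + 1)) p * t, ?_⟩
    rw [map_mul, MvPolynomial.rename_X]
    linear_combination MvPolynomial.X j * hg +
      MvPolynomial.rename (Equiv.swap i (i + 1)) p * ht

/-- The divided difference `∂_i f = (f - s_i f) / (x_i - x_{i+1})`: the (unique) polynomial
whose product with `x_i - x_{i+1}` is `f - s_i f`. -/
noncomputable def divDiff (i : ℕ) (f : Poly) : Poly :=
  (exists_divDiff i f).choose

theorem divDiff_spec (i : ℕ) (f : Poly) :
    (MvPolynomial.X i - MvPolynomial.X (i + 1)) * divDiff i f =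
      f - MvPolynomial.rename (Equiv.swap i (i + 1)) f :=
  (exists_divDiff i f).choose_spec

theorem weight_decreases (n i : ℕ) (w : Equiv.Perm ℕ) (hi : i < n - 1) (h : w i < w (i + 1)) :
    ∑ j ∈ Finset.range n, j * (w * Equiv.swap i (i + 1)) j < ∑ j ∈ Finset.range n, j * w j := by
  have hmem : i ∈ Finset.range n := Finset.mem_range.2 (by omega)
  have hmem' : i + 1 ∈ (Finset.range n).erase i := by simp; omega
  rw [← Finset.add_sum_erase _ _ hmem, ← Finset.add_sum_erase _ _ hmem',
    ← Finset.add_sum_erase (Finset.range n) (fun j => j * w j) hmem,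
    ← Finset.add_sum_erase _ (fun j => j * w j) hmem']
  have hrest : ∑ j ∈ ((Finset.range n).erase i).erase (i + 1),
      j * (w * Equiv.swap i (i + 1)) j =
      ∑ j ∈ ((Finset.range n).erase i).erase (i + 1), j * w j := by
    refine Finset.sum_congr rfl fun j hj => ?_
    simp only [Finset.mem_erase] at hj
    rw [Equiv.Perm.mul_apply, Equiv.swap_apply_of_ne_of_ne hj.2.1 hj.1]
  rw [hrest]
  simp only [Equiv.Perm.mul_apply, Equiv.swap_apply_left, Equiv.swap_apply_right]
  nlinarith

/-- The Schubert polynomial of `w ∈ S_n`: it is `x₁^{n-1} x₂^{n-2} ⋯ x_{n-1}` if `w` is the longest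
element of `S_n` (the one without ascents `w(i) < w(i+1)` among the first `n` positions), and
otherwise it is `∂_i 𝔖_{w s_i}` for the first ascent `i` of `w`. That is,
`𝔖_w = ∂_{w⁻¹ w₀} (x₁^{n-1} x₂^{n-2} ⋯ x_{n-1})`, the operator `∂_{w⁻¹ w₀}` being computed along
a reduced word of `w⁻¹ w₀`. -/
noncomputable def schubertIn (n : ℕ) (w : Equiv.Perm ℕ) : Poly :=
  if h : ∃ i, i < n - 1 ∧ w i < w (i + 1) then
    divDiff (Nat.find h) (schubertIn n (w * Equiv.swap (Nat.find h) (Nat.find h + 1)))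
  else ∏ i ∈ Finset.range n, MvPolynomial.X i ^ (n - 1 - i)
termination_by ∑ j ∈ Finset.range n, j * w j
decreasing_by
  exact weight_decreases n _ w (Nat.find_spec h).1 (Nat.find_spec h).2

theorem exists_degree (w : SInf) : ∃ n : ℕ, ∀ i, n ≤ i → w.1 i = i := by
  obtain ⟨m, hm⟩ := Set.Finite.bddAbove (show {i | w.1 i ≠ i}.Finite from w.2)
  refine ⟨m + 1, fun i hi => ?_⟩
  by_contra h
  have := hm (show i ∈ {i | w.1 i ≠ i} from h)
  omega

open Classical in
/-- The Schubert polynomial `𝔖_w` of `w ∈ S_∞`, computed in the smallest `S_n` that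
contains `w`. -/
noncomputable def schubert (w : SInf) : Poly :=
  schubertIn (Nat.find (exists_degree w)) w.1

/-- `f = ∑_w c_w 𝔖_w`, a finite sum over `w ∈ S_∞` with integer coefficients. -/
def IsSchubertExpansion (f : Poly) (c : SInf →₀ ℤ) : Prop :=
  f = c.sum fun w a => a • schubert w

open Classical in
/-- The structure constants: `structureConst u v w` is `c_{uv}^w`, the coefficient of `𝔖_w` in the
expansion of `𝔖_u 𝔖_v` in Schubert polynomials. -/
noncomputable def structureConst (u v : SInf) : SInf →₀ ℤ :=
  if h : ∃! c : SInf →₀ ℤ, IsSchubertExpansion (schubert u * schubert v) c then h.choose else 0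

/-- One-line notation of the Grassmannian permutation `v(λ, k)`. In letters counted from `1` it
reads `v(i) = i + λ_{k+1-i}` for `i ≤ k` and `v(k + j) = k + j - λ'_j` for `j ≥ 1`, where `λ'` is
the conjugate partition. -/
def grassmannianFun (lam : YoungDiagram) (k : ℕ) (i : ℕ) : ℕ :=
  if i < k then i + lam.rowLen (k - 1 - i) else i - lam.colLen (i - k)

theorem grassmannianFun_strictMono_left (lam : YoungDiagram) (k : ℕ) {i j : ℕ} (hij : i < j)
    (hj : j < k) : grassmannianFun lam k i < grassmannianFun lam k j := by
  have h := lam.rowLen_anti _ _ (show k - 1 - j ≤ k - 1 - i by omega)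
  simp only [grassmannianFun, hj, show i < k by omega, if_true]
  omega

theorem grassmannianFun_strictMono_right (lam : YoungDiagram) (k : ℕ) (hk : lam.colLen 0 ≤ k)
    {i j : ℕ} (hij : i < j) (hi : k ≤ i) : grassmannianFun lam k i < grassmannianFun lam k j := by
  have h := lam.colLen_anti _ _ (show i - k ≤ j - k by omega)
  have h0 := lam.colLen_anti _ _ (Nat.zero_le (i - k))
  simp only [grassmannianFun, show ¬ i < k by omega, show ¬ j < k by omega, if_false]
  omega

theorem grassmannianFun_ne (lam : YoungDiagram) (k : ℕ) (hk : lam.colLen 0 ≤ k)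
    {i j : ℕ} (hi : i < k) (hj : k ≤ j) : grassmannianFun lam k i ≠ grassmannianFun lam k j := by
  have h0 := lam.colLen_anti _ _ (Nat.zero_le (j - k))
  have h1 := YoungDiagram.mem_iff_lt_rowLen (μ := lam) (i := k - 1 - i) (j := j - k)
  have h2 := YoungDiagram.mem_iff_lt_colLen (μ := lam) (i := k - 1 - i) (j := j - k)
  have h3 := h1.symm.trans h2
  simp only [grassmannianFun, hi, show ¬ j < k by omega, if_true, if_false]
  omega

theorem grassmannianFun_injective (lam : YoungDiagram) (k : ℕ) (hk : lam.colLen 0 ≤ k) :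
    Function.Injective (grassmannianFun lam k) := by
  have key : ∀ i j, i < j → grassmannianFun lam k i ≠ grassmannianFun lam k j := by
    intro i j hij
    by_cases hj : j < k
    · exact (grassmannianFun_strictMono_left lam k hij hj).ne
    by_cases hi : i < k
    · exact grassmannianFun_ne lam k hk hi (by omega)
    · exact (grassmannianFun_strictMono_right lam k hk hij (by omega)).ne
  intro i j h
  rcases lt_trichotomy i j with hij | hij | hij
  · exact absurd h (key i j hij)
  · exact hij
  · exact absurd h.symm (key j i hij)

theorem grassmannianFun_eq_self (lam : YoungDiagram) (k i : ℕ) (hi : k + lam.rowLen 0 ≤ i) :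
    grassmannianFun lam k i = i := by
  have h1 := YoungDiagram.mem_iff_lt_rowLen (μ := lam) (i := 0) (j := i - k)
  have h2 := YoungDiagram.mem_iff_lt_colLen (μ := lam) (i := 0) (j := i - k)
  have h3 := h1.symm.trans h2
  simp only [grassmannianFun, show ¬ i < k by omega, if_false]
  omega

theorem grassmannianFun_bijective (lam : YoungDiagram) (k : ℕ) (hk : lam.colLen 0 ≤ k) :
    Function.Bijective (grassmannianFun lam k) := by
  have hinj := grassmannianFun_injective lam k hk
  refine ⟨hinj, fun y => ?_⟩
  by_cases hy : k + lam.rowLen 0 ≤ y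
  · exact ⟨y, grassmannianFun_eq_self lam k y hy⟩
  have hsub : (Finset.range (k + lam.rowLen 0)).image (grassmannianFun lam k) ⊆
      Finset.range (k + lam.rowLen 0) := by
    intro m hm
    obtain ⟨i, hi, rfl⟩ := Finset.mem_image.1 hm
    rw [Finset.mem_range] at hi ⊢
    by_contra hlt
    have := hinj (grassmannianFun_eq_self lam k _ (not_lt.1 hlt))
    omega
  have heq := Finset.eq_of_subset_of_card_le hsub (by rw [Finset.card_image_of_injective _ hinj])
  have hmem : y ∈ Finset.range (k + lam.rowLen 0) := Finset.mem_range.2 (by omega)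
  rw [← heq] at hmem
  obtain ⟨i, -, hi⟩ := Finset.mem_image.1 hmem
  exact ⟨i, hi⟩

/-- The Grassmannian permutation `v(λ, k)`, for a partition `λ` with at most `k` parts: it is
increasing on the first `k` positions and on the remaining ones, and its values at the first `k`
positions are `1 + λ_k < 2 + λ_{k-1} < ⋯ < k + λ_1` (in letters counted from `1`). -/
noncomputable def grassmannian (lam : YoungDiagram) (k : ℕ) (hk : lam.colLen 0 ≤ k) : SInf :=
  ⟨Equiv.ofBijective (grassmannianFun lam k) (grassmannianFun_bijective lam k hk), by
    refine (Set.finite_lt_nat (k + lam.rowLen 0)).subset ?_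
    intro i hi
    by_contra h
    exact hi (grassmannianFun_eq_self lam k i (not_lt.1 h))⟩

end SchubertStructure

/-!
The proof works with the coefficient functionals `coef w` of the Schubert basis and avoids Pieri
and Jacobi-Trudi formulas. Positions and letters are counted from `0`.

*The basis.* The Schubert polynomials satisfy `∂_i 𝔖_u = 𝔖_{u s_i}` or `0`, according to whether
`u` has a descent at `i` (`divDiff_schubert`), and a polynomial is determined by its divided
differences and its constant term (`eq_of_divDiff_eq`). This gives dual functionals, hence linear
independence, and Monk's formula for `x_k 𝔖_u` (`X_mul_schubert`), hence spanning. By Monk's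
formula, `𝔖_u g` involves only `𝔖_w` with `w` above `u` in the Bruhat order, for every polynomial
`g` (`bruhatLE_of_coef_mul_ne_zero`).

*Vanishing.* Let `g` be symmetric in the first `k` variables and contain no others. The Leibniz
rule shows that the coefficient of `𝔖_w` in `𝔖_u g` does not change when `u` and `w` are multiplied
on the right by the same `s_i`, `i + 1 ≠ k`, if both have an ascent or both have a descent at `i`,
and that it vanishes if `w` has a descent and `u` an ascent there. With these exchanges a position
that violates the entrywise conditions `BlockLE k u w` can be moved to the front or to the far
right, where the Bruhat order excludes it (`blockLE_of_coef_mul_ne_zero`). The conditions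
`BlockLE k u w` are equivalent to `u ≤_k w` (`blockLE_of_kBruhatLE`, `BlockLE.kBruhatLE`).

*Invariance.* If `u` and `w` share their first entry, the value of this entry can be changed in both
without changing the coefficient, and likewise for a shared last entry: this is seen by comparing
coefficients in `x_0 𝔖_u g` and `x_n 𝔖_u g` (`coef_sw_mul_of_apply_zero`,
`coef_sw_mul_of_apply_last`). A fixed first letter can be removed by setting the first variable to
`0` (`coef_shift`). Together, a shared last entry can be moved to the front, with `g_k` replaced by
`g_{k+1}` for a family with `g_{k+1}(0, x_0, x_1, …) = g_k` (`coef_mul_cyc`); the polynomials of the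
permutations `v(λ, k)` are such a family because `v(λ, k + 1) = 1 × v(λ, k)`.

Given two pairs with the same `ζ = w u⁻¹`, the sets of the first `k` entries of `w` and the first
`k'` entries of `w'` differ only in letters fixed by `ζ`, and these can be moved to the first block
until the two sets agree. Sorting the entries of `w` and `w'` within the two blocks then makes the
pairs equal (`coef_eq_of_mul_inv_eq`).
-/

namespace SchubertStructure

/-! ### Length and covers -/

/-- The transposition of the positions `a` and `b`, as an element of `S_∞`. -/
def sw (a b : ℕ) : SInf :=
  ⟨Equiv.swap a b, (Set.toFinite {a, b}).subset fun i hi => by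
    by_contra h
    simp only [Set.mem_insert_iff, Set.mem_singleton_iff, not_or] at h
    exact hi (Equiv.swap_apply_of_ne_of_ne h.1 h.2)⟩

theorem sw_val (a b : ℕ) : (sw a b).1 = Equiv.swap a b := rfl

theorem mul_val_apply (u v : SInf) (i : ℕ) : (u * v).1 i = u.1 (v.1 i) := rfl

theorem mul_sw_apply (u : SInf) (a b i : ℕ) : (u * sw a b).1 i = u.1 (Equiv.swap a b i) := rfl

@[simp] theorem one_val_apply (i : ℕ) : (1 : SInf).1 i = i := rfl

@[simp] theorem sw_mul_sw (a b : ℕ) : sw a b * sw a b = 1 :=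
  Subtype.ext (Equiv.swap_mul_self a b)

@[simp] theorem mul_sw_mul_sw (u : SInf) (a b : ℕ) : u * sw a b * sw a b = u := by
  rw [mul_assoc, sw_mul_sw, mul_one]

theorem SInf.ext_apply {u v : SInf} (h : ∀ i, u.1 i = v.1 i) : u = v :=
  Subtype.ext (Equiv.ext h)

theorem val_ne (u : SInf) {i j : ℕ} (h : i ≠ j) : u.1 i ≠ u.1 j := fun e => h (u.1.injective e)

/-- `u` lies in `S_n`: it fixes every letter `≥ n`. -/
def FixesFrom (n : ℕ) (u : SInf) : Prop := ∀ i, n ≤ i → u.1 i = i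

theorem FixesFrom.mono {m n : ℕ} {u : SInf} (h : FixesFrom m u) (hmn : m ≤ n) : FixesFrom n u :=
  fun i hi => h i (hmn.trans hi)

theorem FixesFrom.lt {n : ℕ} {u : SInf} (h : FixesFrom n u) {i : ℕ} (hi : i < n) : u.1 i < n := by
  by_contra hlt
  have := u.1.injective (h _ (not_lt.1 hlt))
  omega

theorem FixesFrom.mul {n : ℕ} {u v : SInf} (hu : FixesFrom n u) (hv : FixesFrom n v) :
    FixesFrom n (u * v) := fun i hi => by rw [mul_val_apply, hv i hi, hu i hi]

theorem fixesFrom_sw {n a b : ℕ} (ha : a < n) (hb : b < n) : FixesFrom n (sw a b) := fun i hi =>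
  Equiv.swap_apply_of_ne_of_ne (by omega) (by omega)

theorem exists_fixesFrom (u : SInf) : ∃ n, FixesFrom n u := exists_degree u

/-- The set of inversions of `u`. -/
def inversions (u : SInf) : Set (ℕ × ℕ) := {p | p.1 < p.2 ∧ u.1 p.2 < u.1 p.1}

theorem length_eq_ncard (u : SInf) : length u = (inversions u).ncard := rfl

theorem FixesFrom.inversion_lt {n : ℕ} {u : SInf} (h : FixesFrom n u) {p : ℕ × ℕ}
    (hp : p ∈ inversions u) : p.2 < n := by
  by_contra hlt
  obtain ⟨h1, h2⟩ := hp
  rw [h p.2 (not_lt.1 hlt)] at h2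
  have := u.1.injective (h (u.1 p.1) (by omega))
  omega

theorem inversions_finite (u : SInf) : (inversions u).Finite := by
  obtain ⟨n, hn⟩ := exists_fixesFrom u
  refine ((Set.finite_lt_nat n).prod (Set.finite_lt_nat n)).subset fun p hp => ?_
  have h1 := hn.inversion_lt hp
  exact ⟨lt_trans hp.1 h1, h1⟩

/-- The combinatorial form of the covers `u ⋖ u (a b)` of the Bruhat order. -/
def Cov (u : SInf) (a b : ℕ) : Prop :=
  a < b ∧ u.1 a < u.1 b ∧ ∀ c, a < c → c < b → u.1 a < u.1 c → u.1 b < u.1 c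

/-- The positions of an inversion of `u` are moved by the transposition `(a b)`, unless this
reverses their order. If `u a < u b`, this maps the inversions of `u` injectively to inversions of
`u (a b)` other than `(a, b)`. -/
def moveInv (a b : ℕ) (p : ℕ × ℕ) : ℕ × ℕ :=
  if Equiv.swap a b p.1 < Equiv.swap a b p.2 then (Equiv.swap a b p.1, Equiv.swap a b p.2) else p

theorem moveInv_moveInv (a b : ℕ) {p : ℕ × ℕ} (hp : p.1 < p.2) :
    moveInv a b (moveInv a b p) = p := by
  unfold moveInv
  by_cases h : Equiv.swap a b p.1 < Equiv.swap a b p.2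
  · simp [h, hp]
  · simp [h]

theorem moveInv_mem {u : SInf} {a b : ℕ} (hab : a < b) (hu : u.1 a < u.1 b) {p : ℕ × ℕ}
    (hp : p ∈ inversions u) : moveInv a b p ∈ inversions (u * sw a b) \ {(a, b)} := by
  obtain ⟨i, j⟩ := p
  obtain ⟨h1, h2⟩ := hp
  simp only at h1 h2
  have hne : (i, j) ≠ (a, b) := by
    rintro h
    simp only [Prod.mk.injEq] at h
    obtain ⟨rfl, rfl⟩ := h
    omega
  unfold moveInv
  simp only
  split_ifs with h
  · refine ⟨⟨h, by simpa [sw_val] using h2⟩, ?_⟩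
    intro h'
    simp only [Set.mem_singleton_iff, Prod.mk.injEq] at h'
    have hi := congrArg (Equiv.swap a b) h'.1
    have hj := congrArg (Equiv.swap a b) h'.2
    simp only [Equiv.swap_apply_self, Equiv.swap_apply_left, Equiv.swap_apply_right] at hi hj
    omega
  · refine ⟨⟨h1, ?_⟩, hne⟩
    simp only [mul_sw_apply]
    simp only [Equiv.swap_apply_def] at h ⊢
    grind

theorem length_add_one_le {u : SInf} {a b : ℕ} (hab : a < b) (hu : u.1 a < u.1 b) :
    length u + 1 ≤ length (u * sw a b) := by
  have hmem : (a, b) ∈ inversions (u * sw a b) :=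
    ⟨hab, by simpa [sw_val] using hu⟩
  rw [length_eq_ncard, length_eq_ncard,
    ← Set.ncard_sdiff_singleton_add_one hmem (inversions_finite _)]
  refine Nat.add_le_add_right (Set.ncard_le_ncard_of_injOn (moveInv a b)
    (fun p hp => moveInv_mem hab hu hp) ?_ ((inversions_finite _).subset Set.sdiff_subset)) 1
  intro p hp q hq h
  rw [← moveInv_moveInv a b hp.1, ← moveInv_moveInv a b hq.1, h]

theorem Cov.length_eq {u : SInf} {a b : ℕ} (h : Cov u a b) :
    length (u * sw a b) = length u + 1 := by
  refine le_antisymm ?_ (length_add_one_le h.1 h.2.1)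
  obtain ⟨hab, hu, hc⟩ := h
  have hmem : (a, b) ∈ inversions (u * sw a b) :=
    ⟨hab, by simpa [sw_val] using hu⟩
  rw [length_eq_ncard, length_eq_ncard,
    ← Set.ncard_sdiff_singleton_add_one hmem (inversions_finite _)]
  refine Nat.add_le_add_right (Set.ncard_le_ncard_of_injOn (moveInv a b) ?_ ?_
    (inversions_finite _)) 1
  · rintro ⟨i, j⟩ ⟨⟨h1, h2⟩, hne⟩
    simp only [Set.mem_singleton_iff, Prod.mk.injEq] at hne
    simp only [mul_sw_apply] at h1 h2
    unfold moveInv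
    simp only
    split_ifs with h
    · exact ⟨h, h2⟩
    · refine ⟨h1, ?_⟩
      simp only
      have hci := hc i
      have hcj := hc j
      simp only [Equiv.swap_apply_def] at h h2
      have hv := @val_ne u
      grind
  · intro p hp q hq h
    rw [← moveInv_moveInv a b hp.1.1, ← moveInv_moveInv a b hq.1.1, h]

theorem cov_of_length_eq {u : SInf} {a b : ℕ} (hab : a < b)
    (h : length (u * sw a b) = length u + 1) : Cov u a b := by
  have hu : u.1 a < u.1 b := by
    by_contra hlt
    have := val_ne u hab.ne
    have h' := length_add_one_le (u := u * sw a b) hab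
      (by simp only [mul_sw_apply, Equiv.swap_apply_left, Equiv.swap_apply_right]; omega)
    rw [mul_sw_mul_sw] at h'
    omega
  refine ⟨hab, hu, fun c hac hcb hc => ?_⟩
  by_contra hlt
  have hcb' : u.1 c < u.1 b := by
    have := val_ne u hcb.ne
    omega
  have hmem : (a, b) ∈ inversions (u * sw a b) :=
    ⟨hab, by simpa [sw_val] using hu⟩
  have hsw : Equiv.swap a b c = c := Equiv.swap_apply_of_ne_of_ne (by omega) (by omega)
  -- a position `c` in between produces the further inversion `(a, c)`
  have hmem' : (a, c) ∈ inversions (u * sw a b) \ {(a, b)} := by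
    refine ⟨⟨hac, ?_⟩, ?_⟩
    · simpa [sw_val, hsw] using hcb'
    · simp only [Set.mem_singleton_iff, Prod.mk.injEq]; omega
  have key : (inversions u).ncard ≤ ((inversions (u * sw a b) \ {(a, b)}) \ {(a, c)}).ncard := by
    refine Set.ncard_le_ncard_of_injOn (moveInv a b)
      (fun p hp => ⟨moveInv_mem hab hu hp, ?_⟩) ?_
      (((inversions_finite _).subset Set.sdiff_subset).subset Set.sdiff_subset)
    · intro hpc
      simp only [Set.mem_singleton_iff] at hpc
      have hp' := moveInv_moveInv a b hp.1
      rw [hpc] at hp'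
      have : moveInv a b (a, c) = (a, c) := by
        unfold moveInv
        simp [hsw, hcb.le]
      rw [this] at hp'
      have := hp.2
      rw [← hp'] at this
      simp only at this
      omega
    · intro p hp q hq h
      rw [← moveInv_moveInv a b hp.1, ← moveInv_moveInv a b hq.1, h]
  have e1 := Set.ncard_sdiff_singleton_add_one hmem (inversions_finite _)
  have e2 := Set.ncard_sdiff_singleton_add_one hmem'
    ((inversions_finite _).subset Set.sdiff_subset)
  rw [length_eq_ncard, length_eq_ncard] at h
  omega

theorem cov_succ {u : SInf} {i : ℕ} (h : u.1 i < u.1 (i + 1)) : Cov u i (i + 1) :=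
  ⟨Nat.lt_succ_self i, h, fun c h1 h2 => by omega⟩

theorem length_mul_sw_of_lt {u : SInf} {i : ℕ} (h : u.1 i < u.1 (i + 1)) :
    length (u * sw i (i + 1)) = length u + 1 := (cov_succ h).length_eq

theorem length_mul_sw_of_gt {u : SInf} {i : ℕ} (h : u.1 (i + 1) < u.1 i) :
    length (u * sw i (i + 1)) + 1 = length u := by
  have := length_mul_sw_of_lt (u := u * sw i (i + 1)) (i := i)
    (by simpa [sw_val] using h)
  rw [mul_sw_mul_sw] at this
  exact this.symm

theorem lt_or_gt_succ (u : SInf) (i : ℕ) : u.1 i < u.1 (i + 1) ∨ u.1 (i + 1) < u.1 i :=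
  lt_or_gt_of_ne (val_ne u (Nat.ne_of_lt (Nat.lt_succ_self i)))

theorem exists_descent {u : SInf} (hu : u ≠ 1) : ∃ i, u.1 (i + 1) < u.1 i := by
  by_contra! h
  have hmono : StrictMono u.1 := strictMono_nat_of_lt_succ fun i => by
    have := h i
    rcases lt_or_gt_succ u i with h' | h' <;> omega
  obtain ⟨n, hn⟩ := exists_fixesFrom u
  refine hu (SInf.ext_apply fun i => ?_)
  have h1 := hmono.le_apply (x := i)
  -- the values at `i, i + 1, …, n` increase and end with `n`
  have h2 : ∀ d, u.1 i + d ≤ u.1 (i + d) := by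
    intro d
    induction d with
    | zero => simp
    | succ d ih => have := hmono (Nat.lt_succ_self (i + d)); grind
  have h3 := h2 n
  rw [hn (i + n) (by omega)] at h3
  simp only [one_val_apply]
  omega

theorem length_one : length (1 : SInf) = 0 := by
  have h : inversions 1 = ∅ := Set.eq_empty_of_forall_notMem fun p hp => by
    obtain ⟨h1, h2⟩ := hp
    simp only [one_val_apply] at h2
    omega
  rw [length_eq_ncard, h, Set.ncard_empty]

theorem length_pos {u : SInf} (hu : u ≠ 1) : 0 < length u := by
  obtain ⟨i, hi⟩ := exists_descent hu
  have := length_mul_sw_of_gt hi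
  omega

open MvPolynomial

/-! ### Divided differences -/

/-- The action of the simple transposition `s_i` on polynomials. -/
noncomputable def sAct (i : ℕ) : Poly →ₐ[ℤ] Poly := rename (Equiv.swap i (i + 1))

theorem sAct_X (i k : ℕ) : sAct i (X k) = X (Equiv.swap i (i + 1) k) := rename_X _ _

theorem sAct_sAct (i : ℕ) (f : Poly) : sAct i (sAct i f) = f := by
  have : (sAct i).comp (sAct i) = AlgHom.id ℤ Poly := by
    refine MvPolynomial.algHom_ext fun k => ?_
    simp [sAct_X]
  exact DFunLike.congr_fun this f

theorem X_sub_X_ne_zero {i j : ℕ} (h : i ≠ j) : (X i - X j : Poly) ≠ 0 := fun e =>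
  h (X_injective (sub_eq_zero.1 e))

theorem divDiff_mul_eq (i : ℕ) (f : Poly) : (X i - X (i + 1)) * divDiff i f = f - sAct i f :=
  divDiff_spec i f

theorem divDiff_eq_of_mul_eq {i : ℕ} {f g : Poly} (h : (X i - X (i + 1)) * g = f - sAct i f) :
    divDiff i f = g :=
  mul_left_cancel₀ (X_sub_X_ne_zero (Nat.ne_of_lt (Nat.lt_succ_self i)))
    ((divDiff_mul_eq i f).trans h.symm)

/-- The divided difference as a linear map. -/
noncomputable def divDiffL (i : ℕ) : Poly →ₗ[ℤ] Poly where
  toFun := divDiff i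
  map_add' f g := divDiff_eq_of_mul_eq (by
    rw [mul_add, divDiff_mul_eq, divDiff_mul_eq, map_add]; ring)
  map_smul' a f := divDiff_eq_of_mul_eq (by
    rw [RingHom.id_apply, mul_smul_comm, divDiff_mul_eq, map_smul, smul_sub])

@[simp] theorem divDiffL_apply (i : ℕ) (f : Poly) : divDiffL i f = divDiff i f := rfl

theorem divDiff_mul (i : ℕ) (f g : Poly) :
    divDiff i (f * g) = divDiff i f * g + sAct i f * divDiff i g :=
  divDiff_eq_of_mul_eq (by
    rw [map_mul]
    linear_combination g * divDiff_mul_eq i f + sAct i f * divDiff_mul_eq i g)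

theorem sAct_eq_self {i : ℕ} {f : Poly} (h : divDiff i f = 0) : sAct i f = f := by
  have := divDiff_mul_eq i f
  rw [h, mul_zero] at this
  exact (sub_eq_zero.1 this.symm).symm

theorem divDiff_eq_zero {i : ℕ} {f : Poly} (h : sAct i f = f) : divDiff i f = 0 :=
  divDiff_eq_of_mul_eq (by rw [h]; ring)

theorem divDiff_mul_of_eq_zero {i : ℕ} (f : Poly) {g : Poly} (h : divDiff i g = 0) :
    divDiff i (f * g) = divDiff i f * g := by
  rw [divDiff_mul, h, mul_zero, add_zero]

theorem sAct_divDiff (i : ℕ) (f : Poly) : sAct i (divDiff i f) = divDiff i f := by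
  have h := congrArg (sAct i) (divDiff_mul_eq i f)
  rw [map_mul, map_sub, map_sub, sAct_X, sAct_X, sAct_sAct, Equiv.swap_apply_left,
    Equiv.swap_apply_right] at h
  refine (divDiff_eq_of_mul_eq ?_).symm
  linear_combination -h

theorem divDiff_divDiff (i : ℕ) (f : Poly) : divDiff i (divDiff i f) = 0 :=
  divDiff_eq_zero (sAct_divDiff i f)

theorem divDiff_X (i k : ℕ) :
    divDiff i (X k) = if k = i then 1 else if k = i + 1 then -1 else 0 := by
  refine divDiff_eq_of_mul_eq ?_
  rw [sAct_X]
  split_ifs with h1 h2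
  · subst h1; simp
  · subst h2; simp
  · rw [Equiv.swap_apply_of_ne_of_ne h1 h2]; simp

theorem sAct_comm {i j : ℕ} (h : i + 2 ≤ j) (f : Poly) :
    sAct i (sAct j f) = sAct j (sAct i f) := by
  have : (sAct i).comp (sAct j) = (sAct j).comp (sAct i) := by
    refine MvPolynomial.algHom_ext fun k => ?_
    simp only [AlgHom.comp_apply, sAct_X]
    congr 1
    simp only [Equiv.swap_apply_def]
    grind
  exact DFunLike.congr_fun this f

theorem sAct_X_of_ne {i k : ℕ} (h1 : k ≠ i) (h2 : k ≠ i + 1) : sAct i (X k) = X k := by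
  rw [sAct_X, Equiv.swap_apply_of_ne_of_ne h1 h2]

theorem sAct_X_self (i : ℕ) : sAct i (X i) = X (i + 1) := by
  rw [sAct_X, Equiv.swap_apply_left]

theorem sAct_X_succ (i : ℕ) : sAct i (X (i + 1)) = X i := by
  rw [sAct_X, Equiv.swap_apply_right]

/-- `(x_i - x_{i+1}) (x_j - x_{j+1}) ∂_i ∂_j f` for commuting `s_i`, `s_j`. -/
theorem mul_divDiff_divDiff {i j : ℕ} (h : i + 2 ≤ j ∨ j + 2 ≤ i) (f : Poly) :
    (X i - X (i + 1)) * (X j - X (j + 1)) * divDiff i (divDiff j f) =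
      f - sAct j f - sAct i f + sAct i (sAct j f) := by
  have h1 := divDiff_mul_eq i (divDiff j f)
  have h2 := divDiff_mul_eq j f
  have h3 := congrArg (sAct i) h2
  rw [map_mul, map_sub, map_sub, sAct_X_of_ne (by omega) (by omega),
    sAct_X_of_ne (by omega) (by omega)] at h3
  linear_combination (X j - X (j + 1)) * h1 + h2 - h3

theorem divDiff_comm {i j : ℕ} (h : i + 2 ≤ j) (f : Poly) :
    divDiff i (divDiff j f) = divDiff j (divDiff i f) := by
  refine mul_left_cancel₀ (mul_ne_zero (X_sub_X_ne_zero (i := i) (j := i + 1) (by omega))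
    (X_sub_X_ne_zero (i := j) (j := j + 1) (by omega))) ?_
  rw [mul_divDiff_divDiff (Or.inl h), mul_comm (X i - X (i + 1)), mul_divDiff_divDiff (Or.inr h),
    sAct_comm h]
  ring

theorem sAct_braid (i : ℕ) (f : Poly) :
    sAct i (sAct (i + 1) (sAct i f)) = sAct (i + 1) (sAct i (sAct (i + 1) f)) := by
  have : (sAct i).comp ((sAct (i + 1)).comp (sAct i)) =
      (sAct (i + 1)).comp ((sAct i).comp (sAct (i + 1))) := by
    refine MvPolynomial.algHom_ext fun k => ?_
    simp only [AlgHom.comp_apply, sAct_X]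
    congr 1
    simp only [Equiv.swap_apply_def]
    grind
  exact DFunLike.congr_fun this f

/-- Both sides, multiplied by the Vandermonde product of `x_i, x_{i+1}, x_{i+2}`, are the
antisymmetrization of `f` in these variables. -/
theorem divDiff_braid (i : ℕ) (f : Poly) :
    divDiff i (divDiff (i + 1) (divDiff i f)) =
      divDiff (i + 1) (divDiff i (divDiff (i + 1) f)) := by
  have n1 : (X i - X (i + 1) : Poly) ≠ 0 := X_sub_X_ne_zero (by omega)
  have n2 : (X (i + 1) - X (i + 1 + 1) : Poly) ≠ 0 := X_sub_X_ne_zero (by omega)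
  have n3 : (X i - X (i + 1 + 1) : Poly) ≠ 0 := X_sub_X_ne_zero (by omega)
  have e1 : sAct i (X (i + 1 + 1)) = X (i + 1 + 1) := sAct_X_of_ne (by omega) (by omega)
  have e2 : sAct (i + 1) (X i) = X i := sAct_X_of_ne (by omega) (by omega)
  have key1 : (X i - X (i + 1)) * (X i - X (i + 1 + 1)) * (X (i + 1) - X (i + 1 + 1)) *
      divDiff i (divDiff (i + 1) (divDiff i f)) =
      f - sAct i f - sAct (i + 1) f + sAct i (sAct (i + 1) f) + sAct (i + 1) (sAct i f) -
        sAct i (sAct (i + 1) (sAct i f)) := by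
    have a0 := divDiff_mul_eq i f
    have a1 := congrArg (sAct (i + 1)) a0
    have a2 := congrArg (sAct i) a1
    have b0 := divDiff_mul_eq (i + 1) (divDiff i f)
    have b1 := congrArg (sAct i) b0
    have c0 := divDiff_mul_eq i (divDiff (i + 1) (divDiff i f))
    simp only [map_mul, map_sub, sAct_X_self, sAct_X_succ, e1, e2, sAct_divDiff] at a1 a2 b1
    linear_combination (X i - X (i + 1 + 1)) * (X (i + 1) - X (i + 1 + 1)) * c0 +
      (X i - X (i + 1 + 1)) * b0 - (X (i + 1) - X (i + 1 + 1)) * b1 + a0 - a1 + a2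
  have key2 : (X i - X (i + 1)) * (X i - X (i + 1 + 1)) * (X (i + 1) - X (i + 1 + 1)) *
      divDiff (i + 1) (divDiff i (divDiff (i + 1) f)) =
      f - sAct i f - sAct (i + 1) f + sAct i (sAct (i + 1) f) + sAct (i + 1) (sAct i f) -
        sAct (i + 1) (sAct i (sAct (i + 1) f)) := by
    have a0 := divDiff_mul_eq (i + 1) f
    have a1 := congrArg (sAct i) a0
    have a2 := congrArg (sAct (i + 1)) a1
    have b0 := divDiff_mul_eq i (divDiff (i + 1) f)
    have b1 := congrArg (sAct (i + 1)) b0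
    have c0 := divDiff_mul_eq (i + 1) (divDiff i (divDiff (i + 1) f))
    simp only [map_mul, map_sub, sAct_X_self, sAct_X_succ, e1, e2, sAct_divDiff] at a1 a2 b1
    linear_combination (X i - X (i + 1 + 1)) * (X i - X (i + 1)) * c0 +
      (X i - X (i + 1 + 1)) * b0 - (X i - X (i + 1)) * b1 + a0 - a1 + a2
  refine mul_left_cancel₀ (mul_ne_zero (mul_ne_zero n1 n3) n2) ?_
  rw [key1, key2, sAct_braid]

/-- A polynomial that is symmetric in all the infinitely many variables is constant. -/
theorem eq_C_of_divDiff_eq_zero {f : Poly} (h : ∀ i, divDiff i f = 0) :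
    f = C (constantCoeff f) := by
  have hstep : ∀ i, i ∈ f.vars → i + 1 ∈ f.vars := by
    intro i hi
    have h1 : i ∈ f.vars.image (Equiv.swap i (i + 1)) := by
      rw [← sAct_eq_self (h i)] at hi
      exact vars_rename _ _ hi
    obtain ⟨k, hk, hki⟩ := Finset.mem_image.1 h1
    have := congrArg (Equiv.swap i (i + 1)) hki
    rw [Equiv.swap_apply_self, Equiv.swap_apply_left] at this
    rwa [← this]
  have hvars : f.vars = ∅ := by
    by_contra hne
    obtain ⟨i, hi⟩ := Finset.nonempty_iff_ne_empty.2 hne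
    have hd : ∀ d, i + d ∈ f.vars := fun d => by
      induction d with
      | zero => exact hi
      | succ d ih => exact hstep _ ih
    have := Finset.le_sup (f := id) (hd (f.vars.sup id + 1))
    simp only [id] at this
    omega
  exact vars_eq_empty_iff_eq_C.1 hvars

theorem eq_of_divDiff_eq {f g : Poly} (h : ∀ i, divDiff i f = divDiff i g)
    (h0 : constantCoeff f = constantCoeff g) : f = g := by
  have h1 := eq_C_of_divDiff_eq_zero (f := f - g) fun i => by
    have := map_sub (divDiffL i) f g
    simp only [divDiffL_apply] at this
    rw [this, h, sub_self]
  rw [map_sub, h0, sub_self, map_zero] at h1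
  exact sub_eq_zero.1 h1

/-- The ideal of polynomials without constant term. -/
noncomputable abbrev augIdeal : Ideal Poly := RingHom.ker (constantCoeff : Poly →+* ℤ)

theorem sAct_mem_augIdeal_pow {i m : ℕ} {f : Poly} (h : f ∈ augIdeal ^ m) :
    sAct i f ∈ augIdeal ^ m := by
  have hle : augIdeal ≤ augIdeal.comap (sAct i) := fun g hg => by
    rw [Ideal.mem_comap, RingHom.mem_ker]
    exact (constantCoeff_rename _ _).trans hg
  exact Ideal.mem_comap.1
    ((Ideal.pow_right_mono hle m).trans (Ideal.le_comap_pow (sAct i) m) h)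

/-- A divided difference lowers the order of vanishing at the origin by at most one. -/
theorem divDiff_mem_augIdeal_pow {i m : ℕ} {f : Poly} (h : f ∈ augIdeal ^ (m + 1)) :
    divDiff i f ∈ augIdeal ^ m := by
  induction m generalizing f with
  | zero => simp
  | succ m ih =>
    rw [pow_succ] at h
    refine Submodule.mul_induction_on h (fun g hg k hk => ?_) fun g k hg hk => ?_
    · rw [divDiff_mul]
      refine Ideal.add_mem _ ?_ ?_
      · rw [pow_succ]
        exact Ideal.mul_mem_mul (ih hg) hk
      · exact Ideal.mul_mem_right _ _ (sAct_mem_augIdeal_pow hg)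
    · have := map_add (divDiffL i) g k
      simp only [divDiffL_apply] at this
      rw [this]
      exact Ideal.add_mem _ hg hk

/-! ### Divided differences of Schubert polynomials -/

theorem schubertIn_of_descending {n : ℕ} {w : Equiv.Perm ℕ}
    (h : ∀ i, i < n - 1 → w (i + 1) < w i) :
    schubertIn n w = ∏ i ∈ Finset.range n, X i ^ (n - 1 - i) := by
  rw [schubertIn, dif_neg]
  rintro ⟨i, hi, hlt⟩
  exact lt_asymm hlt (h i hi)

theorem swap_comm_of_disjoint {a b c d : ℕ} (h1 : a ≠ c) (h2 : a ≠ d) (h3 : b ≠ c) (h4 : b ≠ d) :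
    Equiv.swap a b * Equiv.swap c d = Equiv.swap c d * Equiv.swap a b := by
  ext x
  simp only [Equiv.Perm.mul_apply, Equiv.swap_apply_def]
  grind

theorem swap_braid (j : ℕ) :
    Equiv.swap j (j + 1) * Equiv.swap (j + 1) (j + 1 + 1) * Equiv.swap j (j + 1) =
      Equiv.swap (j + 1) (j + 1 + 1) * Equiv.swap j (j + 1) *
        Equiv.swap (j + 1) (j + 1 + 1) := by
  ext x
  simp only [Equiv.Perm.mul_apply, Equiv.swap_apply_def]
  grind

/-- The recursion that defines the Schubert polynomials holds for every ascent, and not only for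
the first one. By induction this follows from the commutation and braid relations. -/
theorem schubertIn_of_ascent (n : ℕ) (w : Equiv.Perm ℕ) {i : ℕ} (hi : i < n - 1)
    (h : w i < w (i + 1)) :
    schubertIn n w = divDiff i (schubertIn n (w * Equiv.swap i (i + 1))) := by
  induction hN : ∑ j ∈ Finset.range n, j * w j using Nat.strong_induction_on generalizing w i with
  | _ N ih =>
  subst hN
  have hex : ∃ i, i < n - 1 ∧ w i < w (i + 1) := ⟨i, hi, h⟩
  have hle : Nat.find hex ≤ i := Nat.find_min' hex ⟨hi, h⟩
  have hdef : schubertIn n w = divDiff (Nat.find hex)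
      (schubertIn n (w * Equiv.swap (Nat.find hex) (Nat.find hex + 1))) := by
    rw [schubertIn, dif_pos hex]
  obtain ⟨hj, hjw⟩ := Nat.find_spec hex
  generalize Nat.find hex = j at hle hdef hj hjw
  rw [hdef]
  have wi := weight_decreases n i w hi h
  have wj := weight_decreases n j w hj hjw
  rcases Nat.eq_or_lt_of_le hle with rfl | hlt
  · rfl
  rcases Nat.eq_or_lt_of_le (Nat.succ_le_of_lt hlt) with rfl | hlt'
  · -- the ascents `j` and `j + 1` are adjacent: three entries in increasing order
    simp only [Nat.succ_eq_add_one] at *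
    have v1 : Equiv.swap j (j + 1) (j + 1 + 1) = j + 1 + 1 :=
      Equiv.swap_apply_of_ne_of_ne (by omega) (by omega)
    have v2 : Equiv.swap (j + 1) (j + 1 + 1) j = j :=
      Equiv.swap_apply_of_ne_of_ne (by omega) (by omega)
    have p1 : (w * Equiv.swap j (j + 1)) (j + 1) < (w * Equiv.swap j (j + 1)) (j + 1 + 1) := by
      simp only [Equiv.Perm.mul_apply, v1, Equiv.swap_apply_right]; omega
    have p2 : (w * Equiv.swap j (j + 1) * Equiv.swap (j + 1) (j + 1 + 1)) j <
        (w * Equiv.swap j (j + 1) * Equiv.swap (j + 1) (j + 1 + 1)) (j + 1) := by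
      simp only [Equiv.Perm.mul_apply, v1, v2, Equiv.swap_apply_left]; omega
    have q1 : (w * Equiv.swap (j + 1) (j + 1 + 1)) j <
        (w * Equiv.swap (j + 1) (j + 1 + 1)) (j + 1) := by
      simp only [Equiv.Perm.mul_apply, v2, Equiv.swap_apply_left]; omega
    have q2 : (w * Equiv.swap (j + 1) (j + 1 + 1) * Equiv.swap j (j + 1)) (j + 1) <
        (w * Equiv.swap (j + 1) (j + 1 + 1) * Equiv.swap j (j + 1)) (j + 1 + 1) := by
      simp only [Equiv.Perm.mul_apply, v1, v2, Equiv.swap_apply_right]; omega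
    rw [ih _ wj _ hi p1 rfl, ih _ ((weight_decreases n _ _ hi p1).trans wj) _ hj p2 rfl,
      ih _ wi _ hj q1 rfl, ih _ ((weight_decreases n _ _ hj q1).trans wi) _ hi q2 rfl,
      divDiff_braid]
    simp only [mul_assoc]
    rw [← mul_assoc (Equiv.swap j (j + 1)) (Equiv.swap (j + 1) (j + 1 + 1)), swap_braid,
      mul_assoc]
  · have v : ∀ a b, a + 2 ≤ b → Equiv.swap a (a + 1) b = b ∧ Equiv.swap b (b + 1) a = a ∧
        Equiv.swap a (a + 1) (b + 1) = b + 1 ∧ Equiv.swap b (b + 1) (a + 1) = a + 1 := by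
      intro a b hab
      simp only [Equiv.swap_apply_def]
      grind
    obtain ⟨v1, v2, v3, v4⟩ := v j i (by omega)
    rw [ih _ wj _ hi (by simpa only [Equiv.Perm.mul_apply, v1, v3] using h) rfl,
      ih _ wi _ hj (by simpa only [Equiv.Perm.mul_apply, v2, v4] using hjw) rfl,
      divDiff_comm (by omega), mul_assoc, mul_assoc,
      swap_comm_of_disjoint (by omega) (by omega) (by omega) (by omega)]

theorem prod_staircase_succ (n : ℕ) :
    ∏ i ∈ Finset.range (n + 1), (X i : Poly) ^ (n + 1 - 1 - i) =
      (∏ i ∈ Finset.range n, (X i : Poly) ^ (n - 1 - i)) * ∏ i ∈ Finset.Ico 0 n, (X i : Poly) := by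
  rw [Finset.prod_range_succ, ← Finset.range_eq_Ico, ← Finset.prod_mul_distrib]
  simp only [Nat.add_sub_cancel, Nat.sub_self, pow_zero, mul_one]
  refine Finset.prod_congr rfl fun i hi => ?_
  rw [← pow_succ]
  congr 1
  have := Finset.mem_range.1 hi
  omega

theorem sAct_prod_staircase {n j : ℕ} (hj : j < n) :
    sAct j ((∏ i ∈ Finset.range n, (X i : Poly) ^ (n - 1 - i)) *
      ∏ i ∈ Finset.Ico (j + 1) n, (X i : Poly)) =
    (∏ i ∈ Finset.range n, (X i : Poly) ^ (n - 1 - i)) *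
      ∏ i ∈ Finset.Ico (j + 1) n, (X i : Poly) := by
  rcases Nat.eq_or_lt_of_le (Nat.succ_le_of_lt hj) with rfl | hj'
  · -- neither `x_j` nor `x_{j+1}` occurs
    simp only [Nat.succ_eq_add_one, Finset.Ico_self, Finset.prod_empty, mul_one,
      Nat.add_sub_cancel]
    rw [Finset.prod_range_succ, Nat.sub_self, pow_zero, mul_one, map_prod]
    refine Finset.prod_congr rfl fun i hi => ?_
    have := Finset.mem_range.1 hi
    rw [map_pow, sAct_X_of_ne (by omega) (by omega)]
  · have hm : j ∈ Finset.range n := Finset.mem_range.2 hj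
    have hm' : j + 1 ∈ (Finset.range n).erase j :=
      Finset.mem_erase.2 ⟨by omega, Finset.mem_range.2 hj'⟩
    rw [← Finset.mul_prod_erase _ _ hm, ← Finset.mul_prod_erase _ _ hm',
      Finset.prod_eq_prod_Ico_succ_bot hj']
    have h1 : sAct j (∏ i ∈ ((Finset.range n).erase j).erase (j + 1), (X i : Poly) ^ (n - 1 - i)) =
        ∏ i ∈ ((Finset.range n).erase j).erase (j + 1), (X i : Poly) ^ (n - 1 - i) := by
      rw [map_prod]
      refine Finset.prod_congr rfl fun i hi => ?_
      simp only [Finset.mem_erase] at hi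
      rw [map_pow, sAct_X_of_ne hi.2.1 hi.1]
    have h2 : sAct j (∏ i ∈ Finset.Ico (j + 1 + 1) n, (X i : Poly)) =
        ∏ i ∈ Finset.Ico (j + 1 + 1) n, (X i : Poly) := by
      rw [map_prod]
      refine Finset.prod_congr rfl fun i hi => ?_
      have := Finset.mem_Ico.1 hi
      rw [sAct_X_of_ne (by omega) (by omega)]
    have h3 : n - 1 - j = n - 1 - (j + 1) + 1 := by omega
    rw [map_mul, map_mul, map_mul, map_mul, h1, h2, map_pow, map_pow, sAct_X_self, sAct_X_succ,
      h3]
    ring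

/-- The Schubert polynomials in `S_{n+1}` of the permutations obtained from the longest element of
`S_n` by moving the letter `n` from position `n` to position `j`. -/
theorem schubertIn_succ_of_descending {n j : ℕ} (hj : j ≤ n) (w : Equiv.Perm ℕ)
    (h1 : ∀ i i', i < i' → i' ≤ n → i' ≠ j → w i' < w i) (h2 : ∀ i, i < j → w i < w j) :
    schubertIn (n + 1) w =
      (∏ i ∈ Finset.range n, X i ^ (n - 1 - i)) * ∏ i ∈ Finset.Ico j n, X i := by
  induction j generalizing w with
  | zero =>
    rw [schubertIn_of_descending fun i hi => h1 i (i + 1) (by omega) (by omega) (by omega),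
      prod_staircase_succ]
  | succ j ih =>
    rw [schubertIn_of_ascent (n + 1) w (i := j) (by omega) (h2 j (by omega)),
      ih (by omega) (w * Equiv.swap j (j + 1)), Finset.prod_eq_prod_Ico_succ_bot (by omega),
      mul_left_comm, divDiff_mul_of_eq_zero _ (divDiff_eq_zero (sAct_prod_staircase (by omega))),
      divDiff_X, if_pos rfl, one_mul]
    · intro i i' hi hi' hne
      have a1 := h1 i i' hi hi'
      have a2 := h1 j i'
      have a3 := h1 i j
      have a4 := h2 i
      have a5 := h2 j (by omega)
      simp only [Equiv.Perm.mul_apply, Equiv.swap_apply_def]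
      grind
    · intro i hi
      have a4 := h2 i (by omega)
      simp only [Equiv.Perm.mul_apply, Equiv.swap_apply_def]
      grind

theorem schubertIn_succ {n : ℕ} {w : Equiv.Perm ℕ} (hw : ∀ i, n ≤ i → w i = i) :
    schubertIn (n + 1) w = schubertIn n w := by
  induction hN : ∑ j ∈ Finset.range n, j * w j using Nat.strong_induction_on generalizing w with
  | _ N ih =>
  subst hN
  by_cases hex : ∃ i, i < n - 1 ∧ w i < w (i + 1)
  · obtain ⟨i, hi, h⟩ := hex
    rw [schubertIn_of_ascent (n + 1) w (by omega) h, schubertIn_of_ascent n w hi h,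
      ih _ (weight_decreases n i w hi h) (fun k hk => ?_) rfl]
    rw [Equiv.Perm.mul_apply, Equiv.swap_apply_of_ne_of_ne (by omega) (by omega), hw k hk]
  · push Not at hex
    have hdesc : ∀ i, i < n - 1 → w (i + 1) < w i := fun i hi =>
      lt_of_le_of_ne (hex i hi) fun e => by have := w.injective e; omega
    have hdesc' : ∀ i i', i < i' → i' < n → w i' < w i := by
      intro i i' hlt
      induction i', hlt using Nat.le_induction with
      | base => intro h; exact hdesc i (by omega)
      | succ m hm ihm => intro h; exact (hdesc m (by omega)).trans (ihm (by omega))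
    rw [schubertIn_of_descending hdesc,
      schubertIn_succ_of_descending le_rfl w (fun i i' h h' hne => hdesc' i i' h (by omega)),
      Finset.Ico_self, Finset.prod_empty, mul_one]
    intro i hi
    rw [hw n le_rfl]
    by_contra hge
    have := w.injective (hw (w i) (not_lt.1 hge))
    omega

open Classical in
theorem schubert_eq_schubertIn {w : SInf} {n : ℕ} (hw : FixesFrom n w) :
    schubert w = schubertIn n w.1 := by
  have hle : Nat.find (exists_degree w) ≤ n := Nat.find_min' _ hw
  have hspec := Nat.find_spec (exists_degree w)
  rw [schubert]
  generalize Nat.find (exists_degree w) = m at hle hspec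
  induction n, hle using Nat.le_induction with
  | base => rfl
  | succ n hn ih =>
    rw [schubertIn_succ (FixesFrom.mono (u := w) hspec hn)]
    exact ih (FixesFrom.mono (u := w) hspec hn)

theorem schubert_of_ascent {u : SInf} {i : ℕ} (h : u.1 i < u.1 (i + 1)) :
    schubert u = divDiff i (schubert (u * sw i (i + 1))) := by
  obtain ⟨n, hn⟩ := exists_fixesFrom u
  have hn' : FixesFrom (n + i + 2) u := hn.mono (by omega)
  rw [schubert_eq_schubertIn hn', schubert_eq_schubertIn
    (hn'.mul (fixesFrom_sw (a := i) (b := i + 1) (by omega) (by omega)))]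
  exact schubertIn_of_ascent _ _ (by omega) h

theorem divDiff_schubert_of_descent {u : SInf} {i : ℕ} (h : u.1 (i + 1) < u.1 i) :
    divDiff i (schubert u) = schubert (u * sw i (i + 1)) := by
  rw [schubert_of_ascent (u := u * sw i (i + 1)) (i := i) (by simpa [sw_val] using h),
    mul_sw_mul_sw]

theorem divDiff_schubert_of_ascent {u : SInf} {i : ℕ} (h : u.1 i < u.1 (i + 1)) :
    divDiff i (schubert u) = 0 := by
  rw [schubert_of_ascent h, divDiff_divDiff]

theorem divDiff_schubert (u : SInf) (i : ℕ) :
    divDiff i (schubert u) =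
      if u.1 (i + 1) < u.1 i then schubert (u * sw i (i + 1)) else 0 := by
  split_ifs with h
  · exact divDiff_schubert_of_descent h
  · exact divDiff_schubert_of_ascent ((lt_or_gt_succ u i).resolve_right h)

@[simp] theorem schubert_one : schubert 1 = 1 := by
  rw [schubert_eq_schubertIn (n := 0) (fun i _ => rfl), schubertIn_of_descending (by simp)]
  simp

theorem length_le_of_fixesFrom {n : ℕ} {u : SInf} (hu : FixesFrom n u) :
    length u ≤ ∑ i ∈ Finset.range n, (n - 1 - i) := by
  have hsub : inversions u ⊆
      ((Finset.range n).sigma fun i => Finset.Ioo i n).image fun p => (p.1, p.2) := by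
    intro p hp
    have h1 := hu.inversion_lt hp
    simp only [Finset.coe_image, Set.mem_image, Finset.mem_coe, Finset.mem_sigma,
      Finset.mem_range, Finset.mem_Ioo]
    exact ⟨⟨p.1, p.2⟩, ⟨hp.1.trans h1, hp.1, h1⟩, rfl⟩
  rw [length_eq_ncard]
  refine (Set.ncard_le_ncard hsub (Finset.finite_toSet _)).trans ?_
  rw [Set.ncard_coe_finset]
  refine Finset.card_image_le.trans ?_
  rw [Finset.card_sigma]
  simp only [Nat.card_Ioo]
  exact Finset.sum_le_sum fun i _ => by omega

theorem schubert_mem_augIdeal_pow (u : SInf) : schubert u ∈ augIdeal ^ length u := by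
  obtain ⟨n, hn⟩ := exists_fixesFrom u
  induction hN : ∑ j ∈ Finset.range n, j * u.1 j using Nat.strong_induction_on generalizing u with
  | _ N ih =>
  subst hN
  by_cases hex : ∃ i, i < n - 1 ∧ u.1 i < u.1 (i + 1)
  · obtain ⟨i, hi, h⟩ := hex
    have := ih _ (weight_decreases n i u.1 hi h) (u * sw i (i + 1))
      (hn.mul (fixesFrom_sw (by omega) (by omega))) rfl
    rw [length_mul_sw_of_lt h] at this
    rw [schubert_of_ascent h]
    exact divDiff_mem_augIdeal_pow this
  · push Not at hex
    have hdesc : ∀ i, i < n - 1 → u.1 (i + 1) < u.1 i := fun i hi =>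
      lt_of_le_of_ne (hex i hi) (val_ne u (by omega))
    refine Ideal.pow_le_pow_right (length_le_of_fixesFrom hn) ?_
    rw [schubert_eq_schubertIn hn, schubertIn_of_descending hdesc]
    rw [← Finset.prod_pow_eq_pow_sum]
    refine Ideal.prod_mem_prod fun i _ => Ideal.pow_mem_pow ?_ _
    rw [RingHom.mem_ker, constantCoeff_X]

theorem constantCoeff_schubert {u : SInf} (hu : u ≠ 1) : constantCoeff (schubert u) = 0 :=
  RingHom.mem_ker.1 (Ideal.pow_le_self (length_pos hu).ne' (schubert_mem_augIdeal_pow u))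

/-! ### Monk's formula -/

theorem Cov.mul_sw {u : SInf} {a b i : ℕ} (hne : ¬ (a = i ∧ b = i + 1)) (h : Cov u a b)
    (hd : (u * sw a b).1 (i + 1) < (u * sw a b).1 i) :
    u.1 (i + 1) < u.1 i ∧
      Cov (u * sw i (i + 1)) (Equiv.swap i (i + 1) a) (Equiv.swap i (i + 1) b) := by
  obtain ⟨hab, hu, hc⟩ := h
  have hv := @val_ne u
  simp only [mul_sw_apply] at hd
  have hd' : u.1 (i + 1) < u.1 i := by
    have h1 := hc i
    have h2 := hc (i + 1)
    simp only [Equiv.swap_apply_def] at hd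
    grind
  refine ⟨hd', ?_, ?_, fun c => ?_⟩
  · simp only [Equiv.swap_apply_def]; grind
  · simpa [mul_sw_apply, sw_val] using hu
  · have h1 := hc (Equiv.swap i (i + 1) c)
    simp only [mul_sw_apply, Equiv.swap_apply_self]
    simp only [Equiv.swap_apply_def] at hd h1 ⊢
    grind

theorem Cov.of_mul_sw {u : SInf} {a b i : ℕ} (hab : a < b) (hne : ¬ (a = i ∧ b = i + 1))
    (hd' : u.1 (i + 1) < u.1 i)
    (h : Cov (u * sw i (i + 1)) (Equiv.swap i (i + 1) a) (Equiv.swap i (i + 1) b)) :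
    Cov u a b ∧ (u * sw a b).1 (i + 1) < (u * sw a b).1 i := by
  obtain ⟨-, hu, hc⟩ := h
  have hv := @val_ne u
  simp only [mul_sw_apply, Equiv.swap_apply_self] at hu hc
  have hc' : ∀ c, Equiv.swap i (i + 1) a < Equiv.swap i (i + 1) c →
      Equiv.swap i (i + 1) c < Equiv.swap i (i + 1) b → u.1 a < u.1 c → u.1 b < u.1 c := by
    intro c h1 h2
    have := hc _ h1 h2
    rwa [Equiv.swap_apply_self] at this
  have h1 := hc' i
  have h2 := hc' (i + 1)
  refine ⟨⟨hab, hu, fun c => ?_⟩, ?_⟩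
  · by_cases hci : c = i
    · subst hci
      simp only [Equiv.swap_apply_def] at h1 h2
      grind
    by_cases hci' : c = i + 1
    · subst hci'
      simp only [Equiv.swap_apply_def] at h1 h2
      grind
    have h3 := hc' c
    rw [Equiv.swap_apply_of_ne_of_ne hci hci'] at h3
    intro hac hcb
    refine h3 ?_ ?_
    · simp only [Equiv.swap_apply_def]; grind
    · simp only [Equiv.swap_apply_def]; grind
  · simp only [mul_sw_apply]
    rw [Equiv.swap_apply_left] at h1
    rw [Equiv.swap_apply_right] at h2
    clear hc hc'
    have hb := hv (i := i) (j := b)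
    have hb' := hv (i := i + 1) (j := b)
    have ha := hv (i := i) (j := a)
    have ha' := hv (i := i + 1) (j := a)
    clear hv
    by_cases c1 : a = i
    · subst c1
      have e : Equiv.swap a (a + 1) b = b := Equiv.swap_apply_of_ne_of_ne (by omega) (by omega)
      rw [e, Equiv.swap_apply_left] at h1 h2
      rw [Equiv.swap_apply_left, Equiv.swap_apply_of_ne_of_ne (by omega) (by omega)]
      omega
    by_cases c2 : a = i + 1
    · subst c2
      have e : Equiv.swap i (i + 1) b = b := Equiv.swap_apply_of_ne_of_ne (by omega) (by omega)
      rw [e, Equiv.swap_apply_right] at h1 h2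
      rw [Equiv.swap_apply_left, Equiv.swap_apply_of_ne_of_ne (by omega) (by omega)]
      omega
    have e : Equiv.swap i (i + 1) a = a := Equiv.swap_apply_of_ne_of_ne c1 c2
    rw [e] at h1 h2
    by_cases c3 : b = i
    · subst c3
      rw [Equiv.swap_apply_left] at h1 h2
      rw [Equiv.swap_apply_right, Equiv.swap_apply_of_ne_of_ne (by omega) (by omega)]
      omega
    by_cases c4 : b = i + 1
    · subst c4
      rw [Equiv.swap_apply_right] at h1 h2
      rw [Equiv.swap_apply_right, Equiv.swap_apply_of_ne_of_ne (by omega) (by omega)]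
      omega
    rwa [Equiv.swap_apply_of_ne_of_ne (by omega) (by omega),
      Equiv.swap_apply_of_ne_of_ne (by omega) (by omega)]

theorem sw_mul_sw_comm (i a b : ℕ) :
    sw a b * sw i (i + 1) =
      sw i (i + 1) * sw (Equiv.swap i (i + 1) a) (Equiv.swap i (i + 1) b) := by
  refine Subtype.ext ?_
  change Equiv.swap a b * Equiv.swap i (i + 1) = Equiv.swap i (i + 1) *
    Equiv.swap (Equiv.swap i (i + 1) a) (Equiv.swap i (i + 1) b)
  rw [Equiv.swap_mul_eq_mul_swap, Equiv.swap_inv]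

open Classical in
/-- `𝔖_{u (a b)}` if this is a cover of `u`, and `0` otherwise. -/
noncomputable def coverTerm (u : SInf) (a b : ℕ) : Poly :=
  if Cov u a b then schubert (u * sw a b) else 0

theorem coverTerm_of_cov {u : SInf} {a b : ℕ} (h : Cov u a b) :
    coverTerm u a b = schubert (u * sw a b) := if_pos h

theorem coverTerm_of_not_cov {u : SInf} {a b : ℕ} (h : ¬ Cov u a b) : coverTerm u a b = 0 :=
  if_neg h

@[simp] theorem divDiff_zero (i : ℕ) : divDiff i 0 = 0 := map_zero (divDiffL i)

theorem divDiff_coverTerm {u : SInf} {a b i : ℕ} (hne : ¬ (a = i ∧ b = i + 1))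
    (hne' : ¬ (b = i ∧ a = i + 1)) :
    divDiff i (coverTerm u a b) = if u.1 (i + 1) < u.1 i then
      coverTerm (u * sw i (i + 1)) (Equiv.swap i (i + 1) a) (Equiv.swap i (i + 1) b) else 0 := by
  by_cases h : Cov u a b ∧ (u * sw a b).1 (i + 1) < (u * sw a b).1 i
  · obtain ⟨h1, h2⟩ := Cov.mul_sw hne h.1 h.2
    rw [coverTerm_of_cov h.1, if_pos h1, coverTerm_of_cov h2, divDiff_schubert_of_descent h.2,
      mul_assoc, sw_mul_sw_comm, ← mul_assoc]
  · have hl : divDiff i (coverTerm u a b) = 0 := by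
      by_cases hc : Cov u a b
      · rw [coverTerm_of_cov hc, divDiff_schubert, if_neg fun hd => h ⟨hc, hd⟩]
      · rw [coverTerm_of_not_cov hc, divDiff_zero]
    rw [hl]
    split_ifs with hd
    · rw [coverTerm_of_not_cov]
      intro hc
      refine h (Cov.of_mul_sw ?_ hne hd hc)
      have := hc.1
      simp only [Equiv.swap_apply_def] at this
      grind
    · rfl

/-- The term of Monk's formula for `x_k 𝔖_u` that belongs to the transposition `(k b)`. At most
one of the two summands is non-zero: the first for `k < b`, the second for `b < k`. -/
noncomputable def monkTerm (u : SInf) (k b : ℕ) : Poly := coverTerm u k b - coverTerm u b k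

theorem not_cov_of_le {u : SInf} {a b : ℕ} (h : b ≤ a) : ¬ Cov u a b := fun hc => by
  have := hc.1
  omega

theorem divDiff_coverTerm_self (u : SInf) (i : ℕ) :
    divDiff i (coverTerm u i (i + 1)) = if u.1 (i + 1) < u.1 i then 0 else schubert u := by
  split_ifs with h
  · rw [coverTerm_of_not_cov fun hc => lt_asymm h hc.2.1, divDiff_zero]
  · have h' := (lt_or_gt_succ u i).resolve_right h
    rw [coverTerm_of_cov (cov_succ h'), ← schubert_of_ascent h']

theorem coverTerm_mul_sw_of_descent {u : SInf} {i : ℕ} (h : u.1 (i + 1) < u.1 i) :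
    coverTerm (u * sw i (i + 1)) i (i + 1) = schubert u := by
  rw [coverTerm_of_cov (cov_succ (by simpa [sw_val] using h)), mul_sw_mul_sw]

theorem divDiff_sub (i : ℕ) (f g : Poly) : divDiff i (f - g) = divDiff i f - divDiff i g :=
  map_sub (divDiffL i) f g

/-- `∂_i` turns the terms of Monk's formula for `u` into those for `u s_i`; the exceptional
transposition `s_i` itself accounts for the Leibniz term `(∂_i x_k) 𝔖_u`. -/
theorem divDiff_monkTerm (u : SInf) (k b i : ℕ) :
    divDiff i (monkTerm u k b) =
      (if u.1 (i + 1) < u.1 i then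
        monkTerm (u * sw i (i + 1)) (Equiv.swap i (i + 1) k) (Equiv.swap i (i + 1) b) else 0) +
      (if b = Equiv.swap i (i + 1) k then divDiff i (X k) * schubert u else 0) := by
  by_cases h1 : k = i ∧ b = i + 1
  · obtain ⟨rfl, rfl⟩ := h1
    have e := coverTerm_of_not_cov (u := u) (not_cov_of_le (Nat.le_succ k))
    have e' := coverTerm_of_not_cov (u := u * sw k (k + 1)) (not_cov_of_le (Nat.le_succ k))
    simp only [Nat.succ_eq_add_one] at e e'
    simp only [monkTerm, divDiff_sub, divDiff_coverTerm_self, Equiv.swap_apply_left,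
      Equiv.swap_apply_right, e, e', divDiff_zero, divDiff_X, if_true]
    split_ifs with h
    · rw [coverTerm_mul_sw_of_descent h]; ring
    · ring
  by_cases h2 : b = i ∧ k = i + 1
  · obtain ⟨rfl, rfl⟩ := h2
    have e := coverTerm_of_not_cov (u := u) (not_cov_of_le (Nat.le_succ b))
    have e' := coverTerm_of_not_cov (u := u * sw b (b + 1)) (not_cov_of_le (Nat.le_succ b))
    simp only [Nat.succ_eq_add_one] at e e'
    simp only [monkTerm, divDiff_sub, divDiff_coverTerm_self, Equiv.swap_apply_left,
      Equiv.swap_apply_right, e, e', divDiff_zero, divDiff_X, if_true]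
    rw [if_neg (show ¬ b + 1 = b by omega)]
    split_ifs with h
    · rw [coverTerm_mul_sw_of_descent h]; ring
    · ring
  · rw [monkTerm, divDiff_sub, divDiff_coverTerm h1 h2, divDiff_coverTerm
      (fun h => h2 h) (fun h => h1 h)]
    have h3 : (if b = Equiv.swap i (i + 1) k then divDiff i (X k) * schubert u else 0) = 0 := by
      split_ifs with h
      · rw [divDiff_X, if_neg, if_neg, zero_mul]
        · rintro rfl
          rw [Equiv.swap_apply_right] at h
          exact h2 ⟨h, rfl⟩
        · rintro rfl
          rw [Equiv.swap_apply_left] at h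
          exact h1 ⟨rfl, h⟩
      · rfl
    rw [h3, add_zero]
    split_ifs with h
    · rfl
    · rw [sub_zero]

theorem Cov.mul_ne_one {u : SInf} {a b : ℕ} (h : Cov u a b) : u * sw a b ≠ 1 := fun e => by
  have := h.length_eq
  rw [e, length_one] at this
  omega

theorem constantCoeff_coverTerm (u : SInf) (a b : ℕ) : constantCoeff (coverTerm u a b) = 0 := by
  by_cases h : Cov u a b
  · rw [coverTerm_of_cov h, constantCoeff_schubert h.mul_ne_one]
  · rw [coverTerm_of_not_cov h, map_zero]

/-- Monk's formula: `x_k 𝔖_u = ∑_{b > k} 𝔖_{u (k b)} - ∑_{b < k} 𝔖_{u (b k)}`, the sums being over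
the covers of `u`. Both sides satisfy the same recursion under all divided differences. -/
theorem X_mul_schubert {N k : ℕ} {u : SInf} (hu : FixesFrom N u) (hk : k < N) :
    X k * schubert u = ∑ b ∈ Finset.range (N + 1), monkTerm u k b := by
  induction hl : length u using Nat.strong_induction_on generalizing u k with
  | _ l ih =>
  subst hl
  refine eq_of_divDiff_eq (fun i => ?_) ?_
  · have hsum := map_sum (divDiffL i) (monkTerm u k) (Finset.range (N + 1))
    simp only [divDiffL_apply] at hsum
    rw [hsum]
    simp only [divDiff_monkTerm]
    rw [Finset.sum_add_distrib, Finset.sum_ite_eq', divDiff_mul, sAct_X, divDiff_schubert,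
      add_comm (divDiff i (X k) * schubert u)]
    congr 1
    · split_ifs with h
      · have hi : i + 1 < N := by
          by_contra hi
          have h1 := hu (i + 1) (not_lt.1 hi)
          rcases Nat.lt_or_ge i N with h2 | h2
          · have := hu.lt h2; omega
          · have := hu i h2; omega
        rw [ih (length (u * sw i (i + 1))) (by have := length_mul_sw_of_gt h; omega)
          (hu.mul (fixesFrom_sw (by omega) hi)) (k := Equiv.swap i (i + 1) k) ?_ rfl]
        · refine (Finset.sum_equiv (Equiv.swap i (i + 1)) (fun b => ?_) fun b _ => rfl).symm
          simp only [Finset.mem_range, Equiv.swap_apply_def]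
          grind
        · simp only [Equiv.swap_apply_def]
          grind
      · simp
    · split_ifs with h
      · rfl
      · rw [divDiff_X, if_neg, if_neg, zero_mul]
        · rintro rfl
          rw [Equiv.swap_apply_right, Finset.mem_range] at h
          omega
        · rintro rfl
          rw [Equiv.swap_apply_left, Finset.mem_range] at h
          omega
  · rw [map_mul, constantCoeff_X, zero_mul, map_sum]
    refine (Finset.sum_eq_zero fun b _ => ?_).symm
    rw [monkTerm, map_sub, constantCoeff_coverTerm, constantCoeff_coverTerm, sub_zero]

/-! ### The basis of Schubert polynomials -/

/-- Functionals dual to the Schubert polynomials: evaluate at the origin after applying divided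
differences along a reduced word. -/
theorem exists_dual (w : SInf) :
    ∃ φ : Poly →ₗ[ℤ] ℤ, φ (schubert w) = 1 ∧ ∀ v, v ≠ w → φ (schubert v) = 0 := by
  induction hl : length w using Nat.strong_induction_on generalizing w with
  | _ l ih =>
  subst hl
  by_cases hw : w = 1
  · subst hw
    refine ⟨(constantCoeff : Poly →+* ℤ).toAddMonoidHom.toIntLinearMap, by simp, fun v hv => ?_⟩
    exact constantCoeff_schubert hv
  · obtain ⟨i, hi⟩ := exists_descent hw
    obtain ⟨φ, h1, h2⟩ := ih _ (by have := length_mul_sw_of_gt hi; omega) (w * sw i (i + 1)) rfl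
    refine ⟨φ ∘ₗ divDiffL i, ?_, fun v hv => ?_⟩
    · rw [LinearMap.comp_apply, divDiffL_apply, divDiff_schubert_of_descent hi, h1]
    · rw [LinearMap.comp_apply, divDiffL_apply, divDiff_schubert]
      split_ifs with h
      · refine h2 _ fun e => hv ?_
        exact mul_right_cancel e
      · exact map_zero φ

theorem linearIndependent_schubert : LinearIndependent ℤ schubert := by
  rw [linearIndependent_iff]
  intro c hc
  ext w
  obtain ⟨φ, h1, h2⟩ := exists_dual w
  have := congrArg φ hc
  rw [Finsupp.linearCombination_apply, map_finsuppSum, map_zero, Finsupp.sum,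
    Finset.sum_eq_single w] at this
  · rwa [map_smul, h1, smul_eq_mul, mul_one] at this
  · intro v _ hv
    rw [map_smul, h2 v hv, smul_zero]
  · intro hw
    rw [Finsupp.notMem_support_iff.1 hw, zero_smul, map_zero]

theorem coverTerm_mem_span (u : SInf) (a b : ℕ) :
    coverTerm u a b ∈ Submodule.span ℤ (Set.range schubert) := by
  by_cases h : Cov u a b
  · rw [coverTerm_of_cov h]
    exact Submodule.subset_span ⟨_, rfl⟩
  · rw [coverTerm_of_not_cov h]
    exact Submodule.zero_mem _

/-- By Monk's formula the span of the Schubert polynomials is an ideal; it contains `1`. -/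
theorem span_schubert : ⊤ ≤ Submodule.span ℤ (Set.range schubert) := by
  intro f _
  induction f using MvPolynomial.induction_on with
  | C a =>
    have : (C a : Poly) = a • schubert 1 := by simp
    rw [this]
    exact Submodule.smul_mem _ _ (Submodule.subset_span ⟨1, rfl⟩)
  | add p q hp hq => exact Submodule.add_mem _ (hp trivial) (hq trivial)
  | mul_X p k hp =>
    refine Submodule.span_induction (p := fun p _ => p * X k ∈
      Submodule.span ℤ (Set.range schubert)) ?_ ?_ ?_ ?_ (hp trivial)
    · rintro _ ⟨u, rfl⟩
      obtain ⟨n, hn⟩ := exists_fixesFrom u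
      rw [mul_comm, X_mul_schubert (hn.mono (Nat.le_add_right n (k + 1))) (by omega)]
      exact Submodule.sum_mem _ fun b _ =>
        Submodule.sub_mem _ (coverTerm_mem_span _ _ _) (coverTerm_mem_span _ _ _)
    · rw [zero_mul]; exact Submodule.zero_mem _
    · intro x y _ _ hx hy
      rw [add_mul]; exact Submodule.add_mem _ hx hy
    · intro a x _ hx
      rw [smul_mul_assoc]; exact Submodule.smul_mem _ _ hx

/-- The basis of `ℤ[x₁, x₂, …]` formed by the Schubert polynomials. -/
noncomputable def schubertBasis : Module.Basis SInf ℤ Poly :=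
  Module.Basis.mk linearIndependent_schubert span_schubert

@[simp] theorem schubertBasis_apply (w : SInf) : schubertBasis w = schubert w :=
  Module.Basis.mk_apply _ _ _

/-- The coefficient of `𝔖_w` in the expansion of a polynomial. -/
noncomputable def coef (w : SInf) : Poly →ₗ[ℤ] ℤ := schubertBasis.coord w

@[simp] theorem coef_schubert_self (w : SInf) : coef w (schubert w) = 1 := by
  rw [coef, ← schubertBasis_apply, Module.Basis.coord_apply, Module.Basis.repr_self,
    Finsupp.single_eq_same]

theorem coef_schubert_of_ne {v w : SInf} (h : v ≠ w) : coef w (schubert v) = 0 := by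
  rw [coef, ← schubertBasis_apply, Module.Basis.coord_apply, Module.Basis.repr_self,
    Finsupp.single_eq_of_ne h.symm]

theorem isSchubertExpansion_iff (f : Poly) (c : SInf →₀ ℤ) :
    IsSchubertExpansion f c ↔ c = schubertBasis.repr f := by
  have h : (c.sum fun w a => a • schubert w) = schubertBasis.repr.symm c := by
    rw [Module.Basis.repr_symm_apply, Finsupp.linearCombination_apply]
    simp only [schubertBasis_apply]
  rw [IsSchubertExpansion, h, LinearEquiv.eq_symm_apply, eq_comm]

theorem structureConst_eq_repr (u v : SInf) :
    structureConst u v = schubertBasis.repr (schubert u * schubert v) := by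
  have h : ∃! c : SInf →₀ ℤ, IsSchubertExpansion (schubert u * schubert v) c :=
    ⟨_, (isSchubertExpansion_iff _ _).2 rfl, fun c hc => (isSchubertExpansion_iff _ _).1 hc⟩
  rw [structureConst, dif_pos h]
  exact (isSchubertExpansion_iff _ _).1 h.choose_spec.1

theorem structureConst_apply (u v w : SInf) :
    structureConst u v w = coef w (schubert u * schubert v) := by
  rw [structureConst_eq_repr, coef, Module.Basis.coord_apply]

/-! ### Coefficients of products and the Bruhat order -/

theorem coef_mul_eq_sum (w : SInf) (f g : Poly) :
    coef w (f * g) = (schubertBasis.repr f).sum fun v a => a * coef w (schubert v * g) := by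
  conv_lhs => rw [← schubertBasis.linearCombination_repr f, Finsupp.linearCombination_apply,
    Finsupp.sum, Finset.sum_mul, map_sum]
  refine Finset.sum_congr rfl fun v _ => ?_
  rw [schubertBasis_apply, smul_mul_assoc, map_smul, smul_eq_mul]

theorem exists_of_coef_mul_ne_zero {w : SInf} {f g : Poly} (h : coef w (f * g) ≠ 0) :
    ∃ v, coef v f ≠ 0 ∧ coef w (schubert v * g) ≠ 0 := by
  rw [coef_mul_eq_sum] at h
  obtain ⟨v, -, hv⟩ := Finset.exists_ne_zero_of_sum_ne_zero h
  exact ⟨v, left_ne_zero_of_mul hv, right_ne_zero_of_mul hv⟩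

/-- If only `𝔖_v` contributes to the coefficient of `𝔖_w` in `f g = ∑_v' c_v' 𝔖_v' g`. -/
theorem coef_mul_eq_single {w : SInf} {f g : Poly} (v : SInf)
    (h : ∀ v', coef v' f ≠ 0 → coef w (schubert v' * g) ≠ 0 → v' = v) :
    coef w (f * g) = coef v f * coef w (schubert v * g) := by
  rw [coef_mul_eq_sum, Finsupp.sum, Finset.sum_eq_single v]
  · rfl
  · intro v' _ hne
    by_contra hc
    exact hne (h v' (left_ne_zero_of_mul hc) (right_ne_zero_of_mul hc))
  · intro hv
    rw [Finsupp.notMem_support_iff.1 hv, zero_mul]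

theorem coef_eq_coef_divDiff {w : SInf} {i : ℕ} (h : w.1 (i + 1) < w.1 i) (f : Poly) :
    coef w f = coef (w * sw i (i + 1)) (divDiff i f) := by
  have : coef w = coef (w * sw i (i + 1)) ∘ₗ divDiffL i := by
    refine schubertBasis.ext fun v => ?_
    rw [schubertBasis_apply, LinearMap.comp_apply, divDiffL_apply]
    by_cases hv : v = w
    · subst hv
      rw [divDiff_schubert_of_descent h, coef_schubert_self, coef_schubert_self]
    · rw [coef_schubert_of_ne hv, divDiff_schubert]
      split_ifs with hd
      · exact (coef_schubert_of_ne fun e => hv (mul_right_cancel e)).symm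
      · rw [map_zero]
  exact DFunLike.congr_fun this f

theorem coef_mul_of_descent_of_descent {u w : SInf} {i : ℕ} {g : Poly} (hg : divDiff i g = 0)
    (hw : w.1 (i + 1) < w.1 i) (hu : u.1 (i + 1) < u.1 i) :
    coef (w * sw i (i + 1)) (schubert (u * sw i (i + 1)) * g) = coef w (schubert u * g) := by
  rw [coef_eq_coef_divDiff hw, divDiff_mul_of_eq_zero _ hg, divDiff_schubert_of_descent hu]

theorem coef_mul_of_ascent_of_ascent {u w : SInf} {i : ℕ} {g : Poly} (hg : divDiff i g = 0)
    (hw : w.1 i < w.1 (i + 1)) (hu : u.1 i < u.1 (i + 1)) :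
    coef (w * sw i (i + 1)) (schubert (u * sw i (i + 1)) * g) = coef w (schubert u * g) := by
  have := coef_mul_of_descent_of_descent (u := u * sw i (i + 1)) (w := w * sw i (i + 1)) hg
    (by simpa [sw_val] using hw) (by simpa [sw_val] using hu)
  rw [mul_sw_mul_sw, mul_sw_mul_sw] at this
  exact this.symm

theorem coef_mul_of_descent_of_ascent {u w : SInf} {i : ℕ} {g : Poly} (hg : divDiff i g = 0)
    (hw : w.1 (i + 1) < w.1 i) (hu : u.1 i < u.1 (i + 1)) : coef w (schubert u * g) = 0 := by
  rw [coef_eq_coef_divDiff hw, divDiff_mul_of_eq_zero _ hg, divDiff_schubert_of_ascent hu,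
    zero_mul, map_zero]

theorem coef_coverTerm_ne_zero {u w : SInf} {a b : ℕ} (h : coef w (coverTerm u a b) ≠ 0) :
    Cov u a b ∧ w = u * sw a b := by
  by_cases hc : Cov u a b
  · rw [coverTerm_of_cov hc] at h
    refine ⟨hc, ?_⟩
    by_contra hne
    exact h (coef_schubert_of_ne (Ne.symm hne))
  · rw [coverTerm_of_not_cov hc, map_zero] at h
    exact absurd rfl h

theorem coef_X_mul_ne_zero {u w : SInf} {k : ℕ} (h : coef w (X k * schubert u) ≠ 0) :
    ∃ b, (Cov u k b ∧ w = u * sw k b) ∨ (Cov u b k ∧ w = u * sw b k) := by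
  obtain ⟨n, hn⟩ := exists_fixesFrom u
  rw [X_mul_schubert (hn.mono (Nat.le_add_right n (k + 1))) (by omega), map_sum] at h
  obtain ⟨b, -, hb⟩ := Finset.exists_ne_zero_of_sum_ne_zero h
  rw [monkTerm, map_sub] at hb
  refine ⟨b, ?_⟩
  by_cases h1 : coef w (coverTerm u k b) = 0
  · rw [h1, zero_sub, neg_ne_zero] at hb
    exact Or.inr (coef_coverTerm_ne_zero hb)
  · exact Or.inl (coef_coverTerm_ne_zero h1)

theorem sw_comm (a b : ℕ) : sw a b = sw b a := Subtype.ext (Equiv.swap_comm a b)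

theorem sw_left_injective {k b c : ℕ} (h : sw k b = sw k c) : b = c := by
  have := DFunLike.congr_fun (congrArg Subtype.val h) k
  simpa only [sw_val, Equiv.swap_apply_left] using this

theorem coef_X_mul_schubert {u : SInf} (k b : ℕ) :
    coef (u * sw k b) (X k * schubert u) = coef (u * sw k b) (monkTerm u k b) := by
  obtain ⟨n, hn⟩ := exists_fixesFrom u
  rw [X_mul_schubert (hn.mono (Nat.le_add_right n (k + b + 1))) (by omega), map_sum,
    Finset.sum_eq_single b]
  · intro c _ hc
    by_contra h
    rw [monkTerm, map_sub] at h
    have key : u * sw k b = u * sw k c := by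
      by_cases h1 : coef (u * sw k b) (coverTerm u k c) = 0
      · rw [h1, zero_sub, neg_eq_zero] at h
        rw [sw_comm k c]
        exact (coef_coverTerm_ne_zero h).2
      · exact (coef_coverTerm_ne_zero h1).2
    exact hc (sw_left_injective (mul_left_cancel key)).symm
  · intro h
    exact absurd (Finset.mem_range.2 (by omega)) h

theorem coef_X_mul_of_cov_right {u : SInf} {k b : ℕ} (h : Cov u k b) :
    coef (u * sw k b) (X k * schubert u) = 1 := by
  rw [coef_X_mul_schubert, monkTerm, coverTerm_of_cov h,
    coverTerm_of_not_cov (not_cov_of_le h.1.le), sub_zero, coef_schubert_self]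

theorem coef_X_mul_of_cov_left {u : SInf} {k b : ℕ} (h : Cov u b k) :
    coef (u * sw b k) (X k * schubert u) = -1 := by
  rw [sw_comm, coef_X_mul_schubert, monkTerm, coverTerm_of_cov h,
    coverTerm_of_not_cov (not_cov_of_le h.1.le), zero_sub, map_neg, sw_comm b k,
    coef_schubert_self]

/-- The Bruhat order on `S_∞`. -/
def BruhatLE : SInf → SInf → Prop :=
  Relation.ReflTransGen fun u w => ∃ a b, a < b ∧ u.1 a < u.1 b ∧ w = u * sw a b

theorem bruhatLE_of_coef_X_mul_ne_zero {u w : SInf} {k : ℕ}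
    (h : coef w (X k * schubert u) ≠ 0) : BruhatLE u w := by
  obtain ⟨b, ⟨hc, hw⟩ | ⟨hc, hw⟩⟩ := coef_X_mul_ne_zero h
  · exact Relation.ReflTransGen.single ⟨_, _, hc.1, hc.2.1, hw⟩
  · exact Relation.ReflTransGen.single ⟨_, _, hc.1, hc.2.1, hw⟩

/-- Multiplication by any polynomial goes up in the Bruhat order, by Monk's formula. -/
theorem bruhatLE_of_coef_mul_ne_zero {u w : SInf} {g : Poly}
    (h : coef w (schubert u * g) ≠ 0) : BruhatLE u w := by
  induction g using MvPolynomial.induction_on generalizing w with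
  | C a =>
    have e : schubert u * C a = a • schubert u := by
      rw [mul_comm, ← MvPolynomial.smul_eq_C_mul]
    rw [e, map_smul] at h
    by_cases huw : u = w
    · rw [huw]; exact Relation.ReflTransGen.refl
    · rw [coef_schubert_of_ne huw, smul_zero] at h
      exact absurd rfl h
  | add p q hp hq =>
    rw [mul_add, map_add] at h
    by_cases h1 : coef w (schubert u * p) = 0
    · rw [h1, zero_add] at h
      exact hq h
    · exact hp h1
  | mul_X p k hp =>
    rw [← mul_assoc] at h
    obtain ⟨v, h1, h2⟩ := exists_of_coef_mul_ne_zero h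
    rw [mul_comm] at h2
    exact (hp h1).trans (bruhatLE_of_coef_X_mul_ne_zero h2)

theorem BruhatLE.apply_zero_le {u w : SInf} (h : BruhatLE u w) : u.1 0 ≤ w.1 0 := by
  induction h with
  | refl => exact le_rfl
  | tail _ hs ih =>
    obtain ⟨a, b, hab, hlt, rfl⟩ := hs
    refine ih.trans ?_
    rw [mul_sw_apply]
    rcases Nat.eq_zero_or_pos a with rfl | ha
    · rw [Equiv.swap_apply_left]; exact hlt.le
    · rw [Equiv.swap_apply_of_ne_of_ne (by omega) (by omega)]

theorem lt_of_fixesFrom_mul_sw {u : SInf} {a b n : ℕ} (hab : a < b) (hlt : u.1 a < u.1 b)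
    (h : FixesFrom n (u * sw a b)) : b < n := by
  by_contra hb
  have h1 := h b (not_lt.1 hb)
  rw [mul_sw_apply, Equiv.swap_apply_right] at h1
  have h2 : (u * sw a b).1 a = u.1 b := by rw [mul_sw_apply, Equiv.swap_apply_left]
  have h3 := h (u.1 b) (by omega)
  rw [← h2] at h3
  have := (u * sw a b).1.injective h3
  omega

theorem BruhatLE.fixesFrom {u w : SInf} (h : BruhatLE u w) {n : ℕ} (hw : FixesFrom n w) :
    FixesFrom n u := by
  induction h with
  | refl => exact hw
  | @tail v _ _ hs ih =>
    obtain ⟨a, b, hab, hlt, rfl⟩ := hs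
    have hb := lt_of_fixesFrom_mul_sw hab hlt hw
    refine ih ?_
    have := hw.mul (fixesFrom_sw (hab.trans hb) hb)
    rwa [mul_sw_mul_sw] at this

theorem BruhatLE.apply_last_le {u w : SInf} (h : BruhatLE u w) {n : ℕ}
    (hw : FixesFrom (n + 1) w) : w.1 n ≤ u.1 n := by
  induction h with
  | refl => exact le_rfl
  | @tail v _ _ hs ih =>
    obtain ⟨a, b, hab, hlt, rfl⟩ := hs
    have hb := lt_of_fixesFrom_mul_sw hab hlt hw
    have hv := hw.mul (fixesFrom_sw (hab.trans hb) hb)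
    rw [mul_sw_mul_sw] at hv
    refine le_trans ?_ (ih hv)
    rw [mul_sw_apply]
    rcases Nat.eq_or_lt_of_le (Nat.le_of_lt_succ hb) with rfl | hb'
    · rw [Equiv.swap_apply_right]; exact hlt.le
    · rw [Equiv.swap_apply_of_ne_of_ne (by omega) (by omega)]

/-! ### Changing the value of a common first or last entry -/

theorem sw_mul_eq_mul_sw {u : SInf} {a b p q : ℕ} (ha : u.1 a = p) (hb : u.1 b = q) :
    sw p q * u = u * sw a b := by
  refine Subtype.ext ?_
  subst ha hb
  exact (Equiv.mul_swap_eq_swap_mul u.1 a b).symm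

theorem cov_of_adjacent_values {u : SInf} {a b q : ℕ} (hab : a < b) (ha : u.1 a = q)
    (hb : u.1 b = q + 1) : Cov u a b :=
  ⟨hab, by omega, fun c _ h2 h => by have := val_ne u h2.ne; omega⟩

theorem exists_apply_eq (u : SInf) (q : ℕ) : ∃ a, u.1 a = q := u.1.surjective q

theorem sw_mul_apply (u : SInf) (p q i : ℕ) : (sw p q * u).1 i = Equiv.swap p q (u.1 i) := rfl

/-- If `u` and `w` have the same first entry `q`, this entry may be exchanged with the letter
`q + 1` in both of them: compare the coefficients in `x₁ 𝔖_u g`. -/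
theorem coef_sw_mul_of_apply_zero {u w : SInf} {q : ℕ} (hu : u.1 0 = q) (hw : w.1 0 = q)
    (g : Poly) :
    coef (sw q (q + 1) * w) (schubert (sw q (q + 1) * u) * g) = coef w (schubert u * g) := by
  obtain ⟨b, hb⟩ := exists_apply_eq u (q + 1)
  obtain ⟨c, hc⟩ := exists_apply_eq w (q + 1)
  have hb0 : 0 < b := Nat.pos_of_ne_zero fun e => by rw [e] at hb; omega
  have hc0 : 0 < c := Nat.pos_of_ne_zero fun e => by rw [e] at hc; omega
  have hw0 : (sw q (q + 1) * w).1 0 = q + 1 := by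
    rw [sw_mul_apply, hw, Equiv.swap_apply_left]
  have h1 : coef (sw q (q + 1) * w) (X 0 * schubert u * g) =
      coef (sw q (q + 1) * w) (schubert (sw q (q + 1) * u) * g) := by
    rw [coef_mul_eq_single (sw q (q + 1) * u), sw_mul_eq_mul_sw hu hb,
      coef_X_mul_of_cov_right (cov_of_adjacent_values hb0 hu hb), one_mul]
    intro v hv hv'
    have hle := (bruhatLE_of_coef_mul_ne_zero hv').apply_zero_le
    rw [hw0] at hle
    obtain ⟨b', ⟨hcov, rfl⟩ | ⟨hcov, rfl⟩⟩ := coef_X_mul_ne_zero hv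
    · rw [mul_sw_apply, Equiv.swap_apply_left] at hle
      have := hcov.2.1
      rw [sw_mul_eq_mul_sw hu (b := b') (by omega)]
    · exact absurd hcov.1 (Nat.not_lt_zero _)
  have h2 : coef (sw q (q + 1) * w) (schubert u * g * X 0) = coef w (schubert u * g) := by
    rw [coef_mul_eq_single w, mul_comm (schubert w), sw_mul_eq_mul_sw hw hc,
      coef_X_mul_of_cov_right (cov_of_adjacent_values hc0 hw hc), mul_one]
    intro v hv hv'
    have hle := (bruhatLE_of_coef_mul_ne_zero hv).apply_zero_le
    rw [mul_comm] at hv'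
    obtain ⟨b', ⟨hcov, he⟩ | ⟨hcov, he⟩⟩ := coef_X_mul_ne_zero hv'
    · rw [he, mul_sw_apply, Equiv.swap_apply_left] at hw0
      have := hcov.2.1
      rw [← sw_mul_eq_mul_sw (show v.1 0 = q by omega) hw0] at he
      exact (mul_left_cancel he).symm
    · exact absurd hcov.1 (Nat.not_lt_zero _)
  rw [← h1, ← h2]
  congr 1
  ring

/-- If `u` and `w` in `S_{n+1}` have the same last entry `q + 1`, this entry may be exchanged with
the letter `q` in both of them: compare the coefficients in `x_{n+1} 𝔖_u g`. -/
theorem coef_sw_mul_of_apply_last {u w : SInf} {n q : ℕ} (fu : FixesFrom (n + 1) u)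
    (fw : FixesFrom (n + 1) w) (hu : u.1 n = q + 1) (hw : w.1 n = q + 1) (g : Poly) :
    coef (sw q (q + 1) * w) (schubert (sw q (q + 1) * u) * g) = coef w (schubert u * g) := by
  have hpos : ∀ {v : SInf} {b : ℕ}, FixesFrom (n + 1) v → v.1 n = q + 1 → v.1 b = q → b < n := by
    intro v b fv hn hb
    have h1 := fv.lt (Nat.lt_succ_self n)
    by_contra hlt
    rcases Nat.eq_or_lt_of_le (not_lt.1 hlt) with rfl | h
    · omega
    · have := fv b h; omega
  have hqn : q + 1 < n + 1 := by have := fu.lt (Nat.lt_succ_self n); omega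
  obtain ⟨b, hb⟩ := exists_apply_eq u q
  obtain ⟨c, hc⟩ := exists_apply_eq w q
  have fw' : FixesFrom (n + 1) (sw q (q + 1) * w) := (fixesFrom_sw (by omega) hqn).mul fw
  have hwn : (sw q (q + 1) * w).1 n = q := by
    rw [sw_mul_apply, hw, Equiv.swap_apply_right]
  have h1 : coef (sw q (q + 1) * w) (X n * schubert u * g) =
      -coef (sw q (q + 1) * w) (schubert (sw q (q + 1) * u) * g) := by
    rw [coef_mul_eq_single (sw q (q + 1) * u), sw_mul_eq_mul_sw hb hu,
      coef_X_mul_of_cov_left (cov_of_adjacent_values (hpos fu hu hb) hb hu), neg_one_mul]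
    intro v hv hv'
    have hB := bruhatLE_of_coef_mul_ne_zero hv'
    have hle := hB.apply_last_le fw'
    have fv := hB.fixesFrom fw'
    rw [hwn] at hle
    obtain ⟨b', ⟨hcov, rfl⟩ | ⟨hcov, rfl⟩⟩ := coef_X_mul_ne_zero hv
    · have := lt_of_fixesFrom_mul_sw hcov.1 hcov.2.1 fv
      have := hcov.1
      omega
    · rw [mul_sw_apply, Equiv.swap_apply_right] at hle
      have := hcov.2.1
      rw [sw_mul_eq_mul_sw (a := b') (show u.1 b' = q by omega) hu]
  have h2 : coef (sw q (q + 1) * w) (schubert u * g * X n) = -coef w (schubert u * g) := by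
    rw [coef_mul_eq_single w, mul_comm (schubert w), sw_mul_eq_mul_sw hc hw,
      coef_X_mul_of_cov_left (cov_of_adjacent_values (hpos fw hw hc) hc hw), mul_neg_one]
    intro v hv hv'
    rw [mul_comm] at hv'
    have fv := (bruhatLE_of_coef_X_mul_ne_zero hv').fixesFrom fw'
    have hle := (bruhatLE_of_coef_mul_ne_zero hv).apply_last_le fv
    obtain ⟨b', ⟨hcov, he⟩ | ⟨hcov, he⟩⟩ := coef_X_mul_ne_zero hv'
    · rw [he] at fw'
      have := lt_of_fixesFrom_mul_sw hcov.1 hcov.2.1 fw'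
      have := hcov.1
      omega
    · rw [he, mul_sw_apply, Equiv.swap_apply_right] at hwn
      have := hcov.2.1
      rw [← sw_mul_eq_mul_sw hwn (show v.1 n = q + 1 by omega)] at he
      exact (mul_left_cancel he).symm
  rw [← neg_inj, ← h1, ← h2]
  congr 1
  ring

/-! ### Setting the first variable to zero -/

/-- The permutation `1 × u`: the letters of `u` are raised by one, and a fixed first letter is
added. -/
def shift (u : SInf) : SInf :=
  ⟨{ toFun := fun i => Nat.casesOn i 0 fun j => u.1 j + 1
     invFun := fun i => Nat.casesOn i 0 fun j => u.1.symm j + 1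
     left_inv := fun i => by cases i <;> simp
     right_inv := fun i => by cases i <;> simp }, by
    obtain ⟨n, hn⟩ := exists_fixesFrom u
    refine (Set.finite_lt_nat (n + 1)).subset fun i hi => ?_
    by_contra h
    refine hi ?_
    cases i with
    | zero => rfl
    | succ j => exact congrArg (· + 1) (hn j (by simp at h; omega))⟩

@[simp] theorem shift_zero (u : SInf) : (shift u).1 0 = 0 := rfl

@[simp] theorem shift_succ (u : SInf) (j : ℕ) : (shift u).1 (j + 1) = u.1 j + 1 := rfl

theorem swap_succ_succ (a b j : ℕ) :
    Equiv.swap (a + 1) (b + 1) (j + 1) = Equiv.swap a b j + 1 := by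
  simp only [Equiv.swap_apply_def]
  grind

theorem shift_mul_sw (u : SInf) (a b : ℕ) : shift (u * sw a b) = shift u * sw (a + 1) (b + 1) := by
  refine SInf.ext_apply fun i => ?_
  rw [mul_sw_apply]
  cases i with
  | zero => rw [Equiv.swap_apply_of_ne_of_ne (by omega) (by omega), shift_zero, shift_zero]
  | succ j => rw [swap_succ_succ, shift_succ, shift_succ, mul_sw_apply]

theorem shift_injective {u v : SInf} (h : shift u = shift v) : u = v :=
  SInf.ext_apply fun i => by
    have := DFunLike.congr_fun (congrArg Subtype.val h) (i + 1)
    rw [shift_succ, shift_succ] at this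
    omega

@[simp] theorem shift_one : shift 1 = 1 :=
  SInf.ext_apply fun i => by cases i <;> rfl

theorem exists_shift_eq {w : SInf} (h : w.1 0 = 0) : ∃ u, shift u = w := by
  have hpos : ∀ i, w.1 (i + 1) - 1 + 1 = w.1 (i + 1) := fun i => by
    have := val_ne w (Nat.succ_ne_zero i)
    simp only [Nat.succ_eq_add_one] at this
    omega
  have hinv : w.1.symm 0 = 0 := by rw [Equiv.symm_apply_eq, h]
  have hpos' : ∀ i, w.1.symm (i + 1) - 1 + 1 = w.1.symm (i + 1) := fun i => by
    have := w.1.symm.injective.ne (Nat.succ_ne_zero i)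
    simp only [Nat.succ_eq_add_one] at this
    omega
  refine ⟨⟨{ toFun := fun i => w.1 (i + 1) - 1
             invFun := fun i => w.1.symm (i + 1) - 1
             left_inv := fun i => by simp only [hpos, Equiv.symm_apply_apply]; omega
             right_inv := fun i => by simp only [hpos', Equiv.apply_symm_apply]; omega }, ?_⟩, ?_⟩
  · obtain ⟨n, hn⟩ := exists_fixesFrom w
    refine (Set.finite_lt_nat n).subset fun i hi => ?_
    by_contra hlt
    refine hi ?_
    change w.1 (i + 1) - 1 = i
    rw [hn (i + 1) (by simp at hlt; omega)]
    omega
  · refine SInf.ext_apply fun i => ?_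
    cases i with
    | zero => rw [shift_zero, h]
    | succ j => exact hpos j

/-- The substitution `x₁ ↦ 0`, `x_{j+1} ↦ x_j`. -/
noncomputable def dropVar : Poly →ₐ[ℤ] Poly :=
  aeval fun i => Nat.casesOn i 0 fun j => X j

@[simp] theorem dropVar_X_zero : dropVar (X 0) = 0 := aeval_X _ _

@[simp] theorem dropVar_X_succ (j : ℕ) : dropVar (X (j + 1)) = X j := aeval_X _ _

theorem dropVar_sAct (i : ℕ) (f : Poly) : dropVar (sAct (i + 1) f) = sAct i (dropVar f) := by
  have : dropVar.comp (sAct (i + 1)) = (sAct i).comp dropVar := by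
    refine MvPolynomial.algHom_ext fun k => ?_
    simp only [AlgHom.comp_apply, sAct_X]
    cases k with
    | zero =>
      rw [Equiv.swap_apply_of_ne_of_ne (by omega) (by omega), dropVar_X_zero, map_zero]
    | succ k => rw [swap_succ_succ, dropVar_X_succ, dropVar_X_succ, sAct_X]
  exact DFunLike.congr_fun this f

theorem divDiff_dropVar (i : ℕ) (f : Poly) :
    divDiff i (dropVar f) = dropVar (divDiff (i + 1) f) := by
  refine divDiff_eq_of_mul_eq ?_
  have := congrArg dropVar (divDiff_mul_eq (i + 1) f)
  rwa [map_mul, map_sub, map_sub, dropVar_X_succ, dropVar_X_succ, dropVar_sAct] at this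

theorem constantCoeff_dropVar (f : Poly) : constantCoeff (dropVar f) = constantCoeff f := by
  have : (constantCoeff : Poly →+* ℤ).comp dropVar.toRingHom = constantCoeff := by
    refine MvPolynomial.ringHom_ext (fun a => ?_) fun i => ?_
    · simp
    · cases i <;> simp
  exact DFunLike.congr_fun this f

theorem dropVar_schubert_shift (u : SInf) : dropVar (schubert (shift u)) = schubert u := by
  induction hl : length u using Nat.strong_induction_on generalizing u with
  | _ l ih =>
  subst hl
  refine eq_of_divDiff_eq (fun i => ?_) ?_
  · rw [divDiff_dropVar, divDiff_schubert, divDiff_schubert, shift_succ, shift_succ]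
    by_cases h : u.1 (i + 1) < u.1 i
    · rw [if_pos h, if_pos (by omega), ← shift_mul_sw,
        ih _ (by have := length_mul_sw_of_gt h; omega) _ rfl]
    · rw [if_neg h, if_neg (by omega), map_zero]
  · rw [constantCoeff_dropVar]
    by_cases hu : u = 1
    · rw [hu, shift_one]
    · rw [constantCoeff_schubert hu, constantCoeff_schubert]
      intro h
      rw [← shift_one] at h
      exact hu (shift_injective h)

theorem dropVar_schubert_of_ne {v : SInf} (hv : v.1 0 ≠ 0) : dropVar (schubert v) = 0 := by
  induction hl : length v using Nat.strong_induction_on generalizing v with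
  | _ l ih =>
  subst hl
  refine eq_of_divDiff_eq (fun i => ?_) ?_
  · rw [divDiff_dropVar, divDiff_schubert, divDiff_zero]
    split_ifs with h
    · refine ih _ (by have := length_mul_sw_of_gt h; omega) ?_ rfl
      rwa [mul_sw_apply, Equiv.swap_apply_of_ne_of_ne (by omega) (by omega)]
    · rw [map_zero]
  · rw [constantCoeff_dropVar, map_zero, constantCoeff_schubert]
    rintro rfl
    exact hv rfl

theorem coef_shift (w : SInf) (f : Poly) : coef (shift w) f = coef w (dropVar f) := by
  have : coef (shift w) = coef w ∘ₗ dropVar.toLinearMap := by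
    refine schubertBasis.ext fun v => ?_
    rw [schubertBasis_apply, LinearMap.comp_apply, AlgHom.toLinearMap_apply]
    by_cases hv : v.1 0 = 0
    · obtain ⟨u, rfl⟩ := exists_shift_eq hv
      rw [dropVar_schubert_shift]
      by_cases huw : u = w
      · rw [huw, coef_schubert_self, coef_schubert_self]
      · rw [coef_schubert_of_ne huw, coef_schubert_of_ne fun e => huw (shift_injective e)]
    · rw [dropVar_schubert_of_ne hv, map_zero, coef_schubert_of_ne]
      rintro rfl
      exact hv rfl
  exact DFunLike.congr_fun this f

/-! ### The `k`-Bruhat order -/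

/-- The entrywise description of the `k`-Bruhat order: from `u` to `w` the first `k` entries do
not decrease, the others do not increase, and no inversion within one of the two blocks of
positions is created. -/
structure BlockLE (k : ℕ) (u w : SInf) : Prop where
  le_left : ∀ a, a < k → u.1 a ≤ w.1 a
  le_right : ∀ b, k ≤ b → w.1 b ≤ u.1 b
  lt_of_lt : ∀ a b, a < b → (a < k ↔ b < k) → u.1 a < u.1 b → w.1 a < w.1 b

theorem BlockLE.refl (k : ℕ) (u : SInf) : BlockLE k u u :=
  ⟨fun _ _ => le_rfl, fun _ _ => le_rfl, fun _ _ _ _ h => h⟩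

theorem BlockLE.trans {k : ℕ} {u v w : SInf} (h1 : BlockLE k u v) (h2 : BlockLE k v w) :
    BlockLE k u w :=
  ⟨fun a ha => (h1.le_left a ha).trans (h2.le_left a ha),
    fun b hb => (h2.le_right b hb).trans (h1.le_right b hb),
    fun a b hab hk h => h2.lt_of_lt a b hab hk (h1.lt_of_lt a b hab hk h)⟩

theorem blockLE_of_cover {k : ℕ} {u w : SInf} (h : KBruhatCover k u w) : BlockLE k u w := by
  obtain ⟨a, b, ha, hb, hw, hl⟩ := h
  obtain rfl : w = u * sw a b := Subtype.ext hw
  obtain ⟨hab, hlt, hc⟩ := cov_of_length_eq (by omega) hl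
  refine ⟨fun c hck => ?_, fun c hck => ?_, fun c d hcd hk h => ?_⟩
  · rw [mul_sw_apply]
    by_cases e : c = a
    · rw [e, Equiv.swap_apply_left]; exact hlt.le
    · rw [Equiv.swap_apply_of_ne_of_ne e (by omega)]
  · rw [mul_sw_apply]
    by_cases e : c = b
    · rw [e, Equiv.swap_apply_right]; exact hlt.le
    · rw [Equiv.swap_apply_of_ne_of_ne (by omega) e]
  · have h1 := hc c
    have h2 := hc d
    have hv := val_ne u (i := d) (j := b)
    simp only [mul_sw_apply]
    by_cases e1 : c = a
    · subst e1
      rw [Equiv.swap_apply_left, Equiv.swap_apply_of_ne_of_ne (by omega) (by omega)]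
      exact h2 hcd (by omega) h
    by_cases e2 : c = b
    · subst e2
      rw [Equiv.swap_apply_right, Equiv.swap_apply_of_ne_of_ne (by omega) (by omega)]
      omega
    rw [Equiv.swap_apply_of_ne_of_ne e1 e2]
    by_cases e3 : d = a
    · subst e3
      rw [Equiv.swap_apply_left]
      omega
    by_cases e4 : d = b
    · subst e4
      rw [Equiv.swap_apply_right]
      by_contra hge
      have := h1 (by omega) hcd (by have := val_ne u e1; omega)
      omega
    rwa [Equiv.swap_apply_of_ne_of_ne e3 e4]

theorem blockLE_of_kBruhatLE {k : ℕ} {u w : SInf} (h : KBruhatLE k u w) : BlockLE k u w := by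
  induction h with
  | refl => exact BlockLE.refl k u
  | tail _ hs ih => exact ih.trans (blockLE_of_cover hs)

theorem sum_range_eq {n : ℕ} {u : SInf} (hu : FixesFrom n u) :
    ∑ i ∈ Finset.range n, u.1 i = ∑ i ∈ Finset.range n, i := by
  refine Finset.sum_bij (fun i _ => u.1 i) ?_ (fun i _ j _ h => u.1.injective h) ?_
    (fun _ _ => rfl)
  · intro i hi
    exact Finset.mem_range.2 (hu.lt (Finset.mem_range.1 hi))
  · intro j hj
    obtain ⟨i, hi⟩ := exists_apply_eq u j
    refine ⟨i, Finset.mem_range.2 ?_, hi⟩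
    by_contra hlt
    have := hu i (not_lt.1 hlt)
    have := Finset.mem_range.1 hj
    omega

/-- If all of the first `k` entries agree, then so do the others, as the sum of all entries is the
same and they do not increase. -/
theorem BlockLE.eq_of_left {k : ℕ} {u w : SInf} (h : BlockLE k u w)
    (he : ∀ a, a < k → w.1 a = u.1 a) : u = w := by
  obtain ⟨m, hm⟩ := exists_fixesFrom u
  obtain ⟨n, hn⟩ := exists_fixesFrom w
  have hle : ∀ i, w.1 i ≤ u.1 i := fun i => by
    rcases Nat.lt_or_ge i k with hi | hi
    · exact (he i hi).le
    · exact h.le_right i hi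
  have hsum := (sum_range_eq (hm.mono (Nat.le_add_right m n))).trans
    (sum_range_eq (hn.mono (Nat.le_add_left n m))).symm
  refine SInf.ext_apply fun i => ?_
  rcases Nat.lt_or_ge i (m + n) with hi | hi
  · exact ((Finset.sum_eq_sum_iff_of_le fun i _ => hle i).1 hsum.symm i
      (Finset.mem_range.2 hi)).symm
  · rw [hm i (by omega), hn i (by omega)]

/-- The first step of a chain from `u` to `w`: `a` is the position in the first block with the
largest value that has to be raised, and `b` the position in the second block with the smallest
value in `(u a, w a]` that has to be lowered to `u a` or below. -/
theorem BlockLE.exists_cover {k : ℕ} {u w : SInf} (h : BlockLE k u w) (hne : u ≠ w) :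
    ∃ a b, a < k ∧ k ≤ b ∧ Cov u a b ∧ BlockLE k (u * sw a b) w := by
  obtain ⟨h1, h2, h3⟩ := h
  have hex : ((Finset.range k).filter fun a => u.1 a < w.1 a).Nonempty := by
    by_contra hemp
    rw [Finset.not_nonempty_iff_eq_empty, Finset.filter_eq_empty_iff] at hemp
    exact hne (BlockLE.eq_of_left ⟨h1, h2, h3⟩ fun a ha =>
      le_antisymm (not_lt.1 (hemp (Finset.mem_range.2 ha))) (h1 a ha))
  obtain ⟨a, ha, hmax⟩ := Finset.exists_max_image _ (fun a => u.1 a) hex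
  simp only [Finset.mem_filter, Finset.mem_range] at ha hmax
  obtain ⟨hak, hawa⟩ := ha
  have hfix : ∀ c, c < k → u.1 a < u.1 c → w.1 c = u.1 c := fun c hc hlt => by
    by_contra hne'
    have := hmax c ⟨hc, lt_of_le_of_ne (h1 c hc) (Ne.symm hne')⟩
    omega
  -- a value above `u a` whose positions in `u` and `w` differ is in the second block of `u`
  have hright : ∀ j c, u.1 j = w.1 c → c ≠ j → u.1 a < u.1 j → k ≤ j := fun j c hj hcj hlt => by
    by_contra hjk
    have e := hfix j (not_le.1 hjk) hlt
    rw [hj] at e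
    exact hcj (w.1.injective e).symm
  have hS : ∃ m, ∃ j, k ≤ j ∧ u.1 a < u.1 j ∧ u.1 j ≤ w.1 a ∧ w.1 j < u.1 j ∧ u.1 j = m := by
    obtain ⟨j, hj⟩ := exists_apply_eq u (w.1 a)
    have hja : a ≠ j := fun e => by rw [← e] at hj; omega
    have hkj := hright j a hj hja (by omega)
    refine ⟨_, j, hkj, by omega, hj.le, ?_, rfl⟩
    refine lt_of_le_of_ne (h2 j hkj) fun e => hja ?_
    exact (w.1.injective (e.trans hj)).symm
  classical
  have hb : ∃ m, ∃ b, k ≤ b ∧ w.1 b ≤ u.1 a ∧ u.1 a < u.1 b ∧ u.1 b ≤ w.1 a ∧ u.1 b = m := by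
    obtain ⟨j, hkj, hj1, hj2, hj3, hj4⟩ := Nat.find_spec hS
    refine ⟨_, j, hkj, ?_, hj1, hj2, rfl⟩
    by_contra hlt
    obtain ⟨i, hi⟩ := exists_apply_eq u (w.1 j)
    have hij : j ≠ i := fun e => by rw [← e] at hi; omega
    have hki := hright i j hi hij (by omega)
    refine Nat.find_min hS (m := u.1 i) (by omega) ⟨i, hki, by omega, by omega, ?_, rfl⟩
    refine lt_of_le_of_ne (h2 i hki) fun e => hij ?_
    exact (w.1.injective (e.trans hi)).symm
  obtain ⟨b, hkb, hb1, hb2, hb3, hb4⟩ := Nat.find_spec hb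
  have hmin : ∀ c, k ≤ c → w.1 c ≤ u.1 a → u.1 a < u.1 c → u.1 b ≤ u.1 c := fun c hc e1 e2 => by
    by_contra hlt
    exact Nat.find_min hb (m := u.1 c) (by omega) ⟨c, hc, e1, e2, by omega, rfl⟩
  refine ⟨a, b, hak, hkb, ⟨by omega, hb2, fun c hac hcb hc => ?_⟩, ?_, ?_, ?_⟩
  · by_contra hlt
    have hcb' := val_ne u hcb.ne
    rcases Nat.lt_or_ge c k with hck | hck
    · have e1 := hfix c hck hc
      have e2 := h3 a c hac (by omega) hc
      omega
    · have e1 := h3 c b hcb (by omega) (by omega)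
      have e2 := hmin c hck (by omega) hc
      omega
  · intro c hc
    rw [mul_sw_apply]
    by_cases e : c = a
    · rw [e, Equiv.swap_apply_left]; exact hb3
    · rw [Equiv.swap_apply_of_ne_of_ne e (by omega)]; exact h1 c hc
  · intro c hc
    rw [mul_sw_apply]
    by_cases e : c = b
    · rw [e, Equiv.swap_apply_right]; exact hb1
    · rw [Equiv.swap_apply_of_ne_of_ne (by omega) e]; exact h2 c hc
  · intro c d hcd hk
    have e0 := h3 c d hcd hk
    simp only [mul_sw_apply]
    by_cases e1 : c = a
    · subst e1
      rw [Equiv.swap_apply_left, Equiv.swap_apply_of_ne_of_ne (by omega) (by omega)]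
      intro hlt
      exact e0 (by omega)
    by_cases e2 : c = b
    · subst e2
      rw [Equiv.swap_apply_right, Equiv.swap_apply_of_ne_of_ne (by omega) (by omega)]
      intro hlt
      have hne' := val_ne u hcd.ne
      by_cases hwd : w.1 d ≤ u.1 a
      · have := hmin d (by omega) hwd hlt
        exact e0 (by omega)
      · omega
    rw [Equiv.swap_apply_of_ne_of_ne e1 e2]
    by_cases e3 : d = a
    · subst e3
      rw [Equiv.swap_apply_left]
      intro hlt
      have hne' := val_ne u e1
      by_cases hca : u.1 c < u.1 d
      · exact e0 hca
      · have := hfix c (by omega) (by omega)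
        omega
    by_cases e4 : d = b
    · subst e4
      rw [Equiv.swap_apply_right]
      intro hlt
      exact e0 (by omega)
    rw [Equiv.swap_apply_of_ne_of_ne e3 e4]
    exact e0

theorem BlockLE.kBruhatLE {k : ℕ} {u w : SInf} (h : BlockLE k u w) : KBruhatLE k u w := by
  induction hm : ∑ a ∈ Finset.range k, (w.1 a - u.1 a) using Nat.strong_induction_on
    generalizing u with
  | _ m ih =>
  subst hm
  by_cases hne : u = w
  · rw [hne]; exact Relation.ReflTransGen.refl
  obtain ⟨a, b, ha, hb, hc, h'⟩ := h.exists_cover hne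
  refine Relation.ReflTransGen.head ⟨a, b, ha, hb, rfl, hc.length_eq⟩ (ih _ ?_ h' rfl)
  have hval : ∀ c, c < k → c ≠ a → (u * sw a b).1 c = u.1 c := fun c hc hca => by
    rw [mul_sw_apply, Equiv.swap_apply_of_ne_of_ne hca (by omega)]
  have hvala : (u * sw a b).1 a = u.1 b := by rw [mul_sw_apply, Equiv.swap_apply_left]
  have hle := h'.le_left a ha
  have hlt := hc.2.1
  refine Finset.sum_lt_sum (fun c hck => ?_) ⟨a, Finset.mem_range.2 ha, by omega⟩
  by_cases hca : c = a
  · subst hca; omega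
  · rw [hval c (Finset.mem_range.1 hck) hca]

/-! ### Products with a polynomial symmetric in the first `k` variables -/

/-- `g` is a polynomial in `x₁, …, x_k` that is symmetric in these variables (a polynomial killed
by all `∂_i` with `i ≥ k` does not contain `x_{k+1}, x_{k+2}, …`). -/
def IsSymmetricIn (k : ℕ) (g : Poly) : Prop := ∀ i, i + 1 ≠ k → divDiff i g = 0

/-- Multiplying `u` and `w` by `s_i` on the right exchanges two neighbouring entries of the same
block. -/
theorem BlockLE.mul_sw {k : ℕ} {u w : SInf} (h : BlockLE k u w) {i : ℕ} (hi : i + 1 ≠ k)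
    (hiff : u.1 i < u.1 (i + 1) ↔ w.1 i < w.1 (i + 1)) :
    BlockLE k (u * sw i (i + 1)) (w * sw i (i + 1)) := by
  obtain ⟨h1, h2, h3⟩ := h
  have hk : ∀ c, Equiv.swap i (i + 1) c < k ↔ c < k := fun c => by
    simp only [Equiv.swap_apply_def]; grind
  refine ⟨fun a ha => h1 _ ((hk a).2 ha),
    fun b hb => h2 _ (not_lt.1 fun e => not_lt.2 hb ((hk b).1 e)),
    fun a b hab hkab hlt => ?_⟩
  · simp only [mul_sw_apply] at hlt ⊢
    by_cases hab' : a = i ∧ b = i + 1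
    · obtain ⟨rfl, rfl⟩ := hab'
      rw [Equiv.swap_apply_left, Equiv.swap_apply_right] at hlt ⊢
      have := val_ne w hab.ne
      omega
    · refine h3 _ _ ?_ (by rw [hk, hk]; exact hkab) hlt
      simp only [Equiv.swap_apply_def]
      grind

theorem FixesFrom.mul_sw_succ {n i : ℕ} {u : SInf} (hu : FixesFrom n u) (hi : i + 1 < n) :
    FixesFrom n (u * sw i (i + 1)) := hu.mul (fixesFrom_sw (by omega) hi)

/-- The first `i + 1` entries of `w` increase, and the entry at `i` drops from `u` to `w`. Such a
drop can be moved to the first position, where the Bruhat order excludes it. -/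
theorem coef_mul_eq_zero_of_drop {k : ℕ} {g : Poly} (hg : IsSymmetricIn k g) {u w : SInf} {i : ℕ}
    (hi : i < k) (hw : ∀ j, j < i → w.1 j < w.1 (j + 1)) (hlt : w.1 i < u.1 i) :
    coef w (schubert u * g) = 0 := by
  induction i generalizing u w with
  | zero =>
    by_contra h
    have := (bruhatLE_of_coef_mul_ne_zero h).apply_zero_le
    omega
  | succ i ih =>
    have hwi := hw i (Nat.lt_succ_self i)
    rcases lt_or_gt_succ u i with hu | hu
    · rw [← coef_mul_of_ascent_of_ascent (hg i (by omega)) hwi hu]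
      refine ih (by omega) (fun j hj => ?_) ?_
      · rw [mul_sw_apply, mul_sw_apply, Equiv.swap_apply_of_ne_of_ne (by omega) (by omega)]
        by_cases hji : j + 1 = i
        · rw [hji, Equiv.swap_apply_left]
          have := hw j (by omega)
          rw [hji] at this
          omega
        · rw [Equiv.swap_apply_of_ne_of_ne (by omega) (by omega)]
          exact hw j (by omega)
      · rwa [mul_sw_apply, mul_sw_apply, Equiv.swap_apply_left]
    · exact ih (by omega) (fun j hj => hw j (by omega)) (by omega)

/-- The entries of `w` from `i ≥ k` on increase, and the entry at `i` rises from `u` to `w`. Such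
a rise can be moved to the last position, where the Bruhat order excludes it. -/
theorem coef_mul_eq_zero_of_rise {k : ℕ} {g : Poly} (hg : IsSymmetricIn k g) {n d i : ℕ}
    (hd : i + d = n) {u w : SInf} (fu : FixesFrom (n + 1) u) (fw : FixesFrom (n + 1) w)
    (hi : k ≤ i) (hw : ∀ j, i ≤ j → w.1 j < w.1 (j + 1)) (hlt : u.1 i < w.1 i) :
    coef w (schubert u * g) = 0 := by
  induction d generalizing i u w with
  | zero =>
    obtain rfl : i = n := hd
    by_contra h
    have := (bruhatLE_of_coef_mul_ne_zero h).apply_last_le fw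
    omega
  | succ d ih =>
    have hwi := hw i le_rfl
    rcases lt_or_gt_succ u i with hu | hu
    · rw [← coef_mul_of_ascent_of_ascent (hg i (by omega)) hwi hu]
      refine ih (i := i + 1) (by omega) (fu.mul_sw_succ (by omega)) (fw.mul_sw_succ (by omega))
        (by omega) (fun j hj => ?_) ?_
      · rw [mul_sw_apply, mul_sw_apply]
        by_cases hji : j = i + 1
        · rw [hji, Equiv.swap_apply_right, Equiv.swap_apply_of_ne_of_ne (by omega) (by omega)]
          exact hwi.trans (hw (i + 1) (by omega))
        · rw [Equiv.swap_apply_of_ne_of_ne (by omega) (by omega),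
            Equiv.swap_apply_of_ne_of_ne (by omega) (by omega)]
          exact hw j (by omega)
      · rwa [mul_sw_apply, mul_sw_apply, Equiv.swap_apply_right]
    · exact ih (i := i + 1) (by omega) fu fw (by omega) (fun j hj => hw j (by omega)) (by omega)

theorem lt_of_ascents {k : ℕ} {w : SInf} (h : ∀ i, i + 1 ≠ k → w.1 i < w.1 (i + 1)) {a b : ℕ}
    (hab : a < b) (hk : a < k ↔ b < k) : w.1 a < w.1 b := by
  induction b, hab using Nat.le_induction with
  | base => exact h a (by omega)
  | succ b hb ih => exact (ih (by omega)).trans (h b (by omega))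

/-- Only `𝔖_w` with `u ≤_k w` occur in `𝔖_u g`. Exchanging entries of `u` and `w` within the blocks
reduces this to a `w` that increases on both blocks. -/
theorem blockLE_of_coef_mul_ne_zero {k : ℕ} {g : Poly} (hg : IsSymmetricIn k g) {u w : SInf}
    (h : coef w (schubert u * g) ≠ 0) : BlockLE k u w := by
  induction hl : length w using Nat.strong_induction_on generalizing u w with
  | _ l ih =>
  subst hl
  by_cases hex : ∃ i, i + 1 ≠ k ∧ w.1 (i + 1) < w.1 i
  · obtain ⟨i, hi, hwi⟩ := hex
    rcases lt_or_gt_succ u i with hu | hu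
    · exact absurd (coef_mul_of_descent_of_ascent (hg i hi) hwi hu) h
    · rw [← coef_mul_of_descent_of_descent (hg i hi) hwi hu] at h
      have := (ih _ (by have := length_mul_sw_of_gt hwi; omega) h rfl).mul_sw hi (by
        simp only [mul_sw_apply, Equiv.swap_apply_left, Equiv.swap_apply_right]
        exact ⟨fun _ => hwi, fun _ => hu⟩)
      rwa [mul_sw_mul_sw, mul_sw_mul_sw] at this
  · push Not at hex
    have hasc : ∀ i, i + 1 ≠ k → w.1 i < w.1 (i + 1) := fun i hi =>
      lt_of_le_of_ne (hex i hi) (val_ne w (by omega))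
    refine ⟨fun a ha => ?_, fun b hb => ?_, fun a b hab hk _ => ?_⟩
    · by_contra hlt
      exact h (coef_mul_eq_zero_of_drop hg ha (fun j hj => hasc j (by omega)) (by omega))
    · by_contra hlt
      obtain ⟨m, hm⟩ := exists_fixesFrom u
      obtain ⟨n, hn⟩ := exists_fixesFrom w
      exact h (coef_mul_eq_zero_of_rise hg (n := b + (m + n)) (d := m + n) rfl
        (hm.mono (by omega)) (hn.mono (by omega)) hb (fun j hj => hasc j (by omega)) (by omega))
    · exact lt_of_ascents hasc hab hk

/-! ### Moving a common entry from the second block to the first -/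

/-- The cycle with one-line notation `n, 0, 1, …, n - 1, n + 1, …`. -/
def cyc : ℕ → SInf
  | 0 => 1
  | n + 1 => sw n (n + 1) * cyc n

theorem cyc_zero_apply (n : ℕ) : (cyc n).1 0 = n := by
  induction n with
  | zero => rfl
  | succ n ih => rw [cyc, sw_mul_apply, ih, Equiv.swap_apply_left]

theorem cyc_succ_apply (n j : ℕ) : (cyc n).1 (j + 1) = if j < n then j else j + 1 := by
  induction n with
  | zero => rfl
  | succ n ih =>
    rw [cyc, sw_mul_apply, ih]
    simp only [Equiv.swap_apply_def]
    grind

theorem cyc_mul_shift {n : ℕ} {u : SInf} (hu : FixesFrom n u) :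
    cyc n * shift u = u * cyc n := by
  refine SInf.ext_apply fun i => ?_
  rw [mul_val_apply, mul_val_apply]
  cases i with
  | zero => rw [shift_zero, cyc_zero_apply, hu n le_rfl]
  | succ j =>
    rw [shift_succ, cyc_succ_apply, cyc_succ_apply]
    by_cases hj : j < n
    · rw [if_pos hj, if_pos (hu.lt hj)]
    · rw [if_neg hj, hu j (by omega), if_neg hj, hu (j + 1) (by omega)]

theorem coef_cyc_mul_shift (n : ℕ) (u w : SInf) (g : Poly) :
    coef (cyc n * shift w) (schubert (cyc n * shift u) * g) =
      coef w (schubert u * dropVar g) := by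
  induction n with
  | zero =>
    rw [cyc, one_mul, one_mul, coef_shift, map_mul, dropVar_schubert_shift]
  | succ n ih =>
    have h : ∀ v : SInf, (cyc n * shift v).1 0 = n := fun v => by
      rw [mul_val_apply, shift_zero, cyc_zero_apply]
    rw [cyc, mul_assoc, mul_assoc, coef_sw_mul_of_apply_zero (h u) (h w), ih]

/-- A common last entry of `u` and `w` may be moved to the front of both, if a first variable is
added to `g`. To see this, the entry is raised to the largest letter, so that it can be removed,
a fixed first letter is inserted, and the value of the first entry is restored. -/
theorem coef_mul_cyc {n d : ℕ} {u w : SInf} (fu : FixesFrom (n + 1) u) (fw : FixesFrom (n + 1) w)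
    (hd : u.1 n + d = n) (huw : w.1 n = u.1 n) (g : Poly) :
    coef (w * cyc n) (schubert (u * cyc n) * g) = coef w (schubert u * dropVar g) := by
  induction d generalizing u w with
  | zero =>
    have h : ∀ v : SInf, FixesFrom (n + 1) v → v.1 n = n → FixesFrom n v := fun v fv hv i hi => by
      rcases Nat.eq_or_lt_of_le hi with rfl | hi'
      · exact hv
      · exact fv i hi'
    rw [← cyc_mul_shift (h u fu (by omega)), ← cyc_mul_shift (h w fw (by omega)),
      coef_cyc_mul_shift]
  | succ d ih =>
    have hn : u.1 n + 1 < n + 1 := by omega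
    have fs : FixesFrom (n + 1) (sw (u.1 n) (u.1 n + 1)) := fixesFrom_sw (by omega) hn
    have hu' : (sw (u.1 n) (u.1 n + 1) * u).1 n = u.1 n + 1 := by
      rw [sw_mul_apply, Equiv.swap_apply_left]
    have hw' : (sw (u.1 n) (u.1 n + 1) * w).1 n = u.1 n + 1 := by
      rw [sw_mul_apply, huw, Equiv.swap_apply_left]
    have h1 := ih (fs.mul fu) (fs.mul fw) (by omega) (hw'.trans hu'.symm)
    have h2 := coef_sw_mul_of_apply_last (fs.mul fu) (fs.mul fw) hu' hw' (dropVar g)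
    rw [← mul_assoc, ← mul_assoc, sw_mul_sw, one_mul, one_mul] at h2
    have h3 := coef_sw_mul_of_apply_zero (u := u * cyc n) (w := w * cyc n) (q := u.1 n)
      (by rw [mul_val_apply, cyc_zero_apply]) (by rw [mul_val_apply, cyc_zero_apply, huw]) g
    rw [← mul_assoc, ← mul_assoc] at h3
    rw [← h3, h1, h2]

/-- The set of the first `k` entries of `w`. -/
def firstValues (k : ℕ) (w : SInf) : Finset ℕ := (Finset.range k).image w.1

theorem mem_firstValues {k x : ℕ} {w : SInf} : x ∈ firstValues k w ↔ ∃ a, a < k ∧ w.1 a = x := by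
  simp only [firstValues, Finset.mem_image, Finset.mem_range]

theorem card_firstValues (k : ℕ) (w : SInf) : (firstValues k w).card = k := by
  rw [firstValues, Finset.card_image_of_injective _ w.1.injective, Finset.card_range]

theorem firstValues_mul_sw {k i : ℕ} (hi : i + 1 ≠ k) (w : SInf) :
    firstValues k (w * sw i (i + 1)) = firstValues k w := by
  have hk : ∀ c, Equiv.swap i (i + 1) c < k ↔ c < k := fun c => by
    simp only [Equiv.swap_apply_def]; grind
  ext x
  simp only [mem_firstValues, mul_sw_apply]
  constructor
  · rintro ⟨a, ha, rfl⟩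
    exact ⟨_, (hk a).2 ha, rfl⟩
  · rintro ⟨a, ha, rfl⟩
    exact ⟨_, (hk a).2 ha, by rw [Equiv.swap_apply_self]⟩

/-- A common entry of `u` and `w` in the second block can be moved past its right neighbours. -/
theorem BlockLE.exists_move_right {k : ℕ} {g : Poly} (hg : IsSymmetricIn k g) {n d j : ℕ}
    (hd : j + d = n) {u w : SInf} (h : BlockLE k u w) (fu : FixesFrom (n + 1) u)
    (fw : FixesFrom (n + 1) w) (hj : k ≤ j) (huw : w.1 j = u.1 j) :
    ∃ s : SInf, BlockLE k (u * s) (w * s) ∧ FixesFrom (n + 1) (u * s) ∧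
      FixesFrom (n + 1) (w * s) ∧ (w * s).1 n = w.1 j ∧ (u * s).1 n = w.1 j ∧
      firstValues k (w * s) = firstValues k w ∧
      coef (w * s) (schubert (u * s) * g) = coef w (schubert u * g) := by
  induction d generalizing j u w with
  | zero =>
    obtain rfl : j = n := hd
    refine ⟨1, ?_⟩
    rw [mul_one, mul_one]
    exact ⟨h, fu, fw, rfl, huw.symm, rfl, rfl⟩
  | succ d ih =>
    have hle := h.le_right (j + 1) (by omega)
    have hlt := h.lt_of_lt j (j + 1) (by omega) (by omega)
    have hne := val_ne w (show j ≠ j + 1 by omega)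
    have hiff : u.1 j < u.1 (j + 1) ↔ w.1 j < w.1 (j + 1) := by omega
    have hcoef : coef (w * sw j (j + 1)) (schubert (u * sw j (j + 1)) * g) =
        coef w (schubert u * g) := by
      rcases lt_or_gt_succ u j with hu | hu
      · exact coef_mul_of_ascent_of_ascent (hg j (by omega)) (hlt hu) hu
      · exact coef_mul_of_descent_of_descent (hg j (by omega)) (by omega) hu
    have hval : ∀ v : SInf, (v * sw j (j + 1)).1 (j + 1) = v.1 j := fun v => by
      rw [mul_sw_apply, Equiv.swap_apply_right]
    obtain ⟨s, h1, h2, h3, h4, h5, h6, h7⟩ := ih (j := j + 1) (by omega)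
      (h.mul_sw (by omega) hiff) (fu.mul_sw_succ (by omega)) (fw.mul_sw_succ (by omega))
      (by omega) (by rw [hval, hval, huw])
    rw [hval] at h4 h5
    rw [firstValues_mul_sw (by omega)] at h6
    rw [hcoef] at h7
    refine ⟨sw j (j + 1) * s, ?_⟩
    rw [← mul_assoc, ← mul_assoc]
    exact ⟨h1, h2, h3, h4, h5, h6, h7⟩

theorem BlockLE.mul_cyc {k n : ℕ} {u w : SInf} (h : BlockLE k u w) (hk : k ≤ n)
    (huw : w.1 n = u.1 n) : BlockLE (k + 1) (u * cyc n) (w * cyc n) := by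
  obtain ⟨h1, h2, h3⟩ := h
  refine ⟨fun a ha => ?_, fun b hb => ?_, fun a b hab hkab hlt => ?_⟩
  · rw [mul_val_apply, mul_val_apply]
    cases a with
    | zero => rw [cyc_zero_apply, huw]
    | succ a =>
      rw [cyc_succ_apply, if_pos (by omega)]
      exact h1 a (by omega)
  · rw [mul_val_apply, mul_val_apply]
    cases b with
    | zero => omega
    | succ b =>
      rw [cyc_succ_apply]
      split_ifs
      · exact h2 b (by omega)
      · exact h2 (b + 1) (by omega)
  · rw [mul_val_apply, mul_val_apply] at hlt ⊢
    cases b with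
    | zero => omega
    | succ b =>
      cases a with
      | zero =>
        have hb := h1 b (by omega)
        rw [cyc_zero_apply, cyc_succ_apply, if_pos (by omega)] at hlt ⊢
        omega
      | succ a =>
        refine h3 _ _ ?_ ?_ hlt
        · rw [cyc_succ_apply, cyc_succ_apply]; grind
        · rw [cyc_succ_apply, cyc_succ_apply]; grind

theorem firstValues_mul_cyc {k n : ℕ} (hk : k ≤ n) (w : SInf) :
    firstValues (k + 1) (w * cyc n) = insert (w.1 n) (firstValues k w) := by
  ext x
  simp only [mem_firstValues, Finset.mem_insert, mul_val_apply]
  constructor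
  · rintro ⟨a, ha, rfl⟩
    cases a with
    | zero => exact Or.inl (by rw [cyc_zero_apply])
    | succ a =>
      rw [cyc_succ_apply, if_pos (by omega)]
      exact Or.inr ⟨a, by omega, rfl⟩
  · rintro (rfl | ⟨a, ha, rfl⟩)
    · exact ⟨0, by omega, by rw [cyc_zero_apply]⟩
    · exact ⟨a + 1, by omega, by rw [cyc_succ_apply, if_pos (by omega)]⟩

/-- A common entry of `u` and `w` in the second block can be moved to the first block, without
changing `w u⁻¹`, if a variable is added to `g`. -/
theorem BlockLE.exists_enlarge {k : ℕ} {g : Poly} (hg : IsSymmetricIn k (dropVar g)) {j : ℕ}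
    {u w : SInf} (h : BlockLE k u w) (hj : k ≤ j) (huw : w.1 j = u.1 j) :
    ∃ s : SInf, BlockLE (k + 1) (u * s) (w * s) ∧
      firstValues (k + 1) (w * s) = insert (w.1 j) (firstValues k w) ∧
      coef (w * s) (schubert (u * s) * g) = coef w (schubert u * dropVar g) := by
  obtain ⟨m, hm⟩ := exists_fixesFrom u
  obtain ⟨n, hn⟩ := exists_fixesFrom w
  obtain ⟨s, h1, h2, h3, h4, h5, h6, h7⟩ := h.exists_move_right hg (n := j + (m + n)) rfl
    (hm.mono (by omega)) (hn.mono (by omega)) hj huw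
  have hle := h2.lt (Nat.lt_succ_self (j + (m + n)))
  refine ⟨s * cyc (j + (m + n)), ?_, ?_, ?_⟩
  · rw [← mul_assoc, ← mul_assoc]
    exact h1.mul_cyc (by omega) (h4.trans h5.symm)
  · rw [← mul_assoc, firstValues_mul_cyc (by omega), h4, h6]
  · rw [← mul_assoc, ← mul_assoc, coef_mul_cyc h2 h3 (Nat.add_sub_cancel' (by omega))
      (h4.trans h5.symm), h7]

/-! ### Independence of the pair `u ≤_k w` -/

/-- The entries of `w` can be sorted within the two blocks. -/
theorem BlockLE.exists_sort {k : ℕ} {g : Poly} (hg : IsSymmetricIn k g) {u w : SInf}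
    (h : BlockLE k u w) :
    ∃ s : SInf, (∀ i, i + 1 ≠ k → (w * s).1 i < (w * s).1 (i + 1)) ∧
      firstValues k (w * s) = firstValues k w ∧
      coef (w * s) (schubert (u * s) * g) = coef w (schubert u * g) := by
  induction hl : length w using Nat.strong_induction_on generalizing u w with
  | _ l ih =>
  subst hl
  by_cases hex : ∃ i, i + 1 ≠ k ∧ w.1 (i + 1) < w.1 i
  · obtain ⟨i, hi, hwi⟩ := hex
    have hui : u.1 (i + 1) < u.1 i := (lt_or_gt_succ u i).resolve_left fun hu =>
      lt_asymm hwi (h.lt_of_lt i (i + 1) (by omega) (by omega) hu)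
    obtain ⟨s, h1, h2, h3⟩ := ih _ (by have := length_mul_sw_of_gt hwi; omega)
      (h.mul_sw hi (by omega)) rfl
    refine ⟨sw i (i + 1) * s, ?_⟩
    rw [← mul_assoc, ← mul_assoc]
    rw [firstValues_mul_sw hi] at h2
    rw [coef_mul_of_descent_of_descent (hg i hi) hwi hui] at h3
    exact ⟨h1, h2, h3⟩
  · push Not at hex
    refine ⟨1, ?_⟩
    rw [mul_one, mul_one]
    exact ⟨fun i hi => lt_of_le_of_ne (hex i hi) (val_ne w (by omega)), rfl, rfl⟩

theorem eq_of_ascents {k : ℕ} {w w' : SInf} (h : ∀ i, i + 1 ≠ k → w.1 i < w.1 (i + 1))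
    (h' : ∀ i, i + 1 ≠ k → w'.1 i < w'.1 (i + 1)) (he : firstValues k w = firstValues k w') :
    w = w' := by
  have hl : (fun a : Fin k => w.1 a) = fun a : Fin k => w'.1 a := by
    have hmono : ∀ v : SInf, (∀ i, i + 1 ≠ k → v.1 i < v.1 (i + 1)) →
        StrictMono fun a : Fin k => v.1 a :=
      fun v hv a b hab => lt_of_ascents hv hab (iff_of_true a.2 b.2)
    refine (StrictMono.range_inj (hmono w h) (hmono w' h')).1 ?_
    have : ∀ v : SInf, Set.range (fun a : Fin k => v.1 a) = firstValues k v := fun v => by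
      ext x
      simp only [Set.mem_range, Finset.mem_coe, mem_firstValues]
      exact ⟨fun ⟨a, ha⟩ => ⟨a, a.2, ha⟩, fun ⟨a, ha, hx⟩ => ⟨⟨a, ha⟩, hx⟩⟩
    rw [this, this, he]
  have hr : (fun a : ℕ => w.1 (k + a)) = fun a : ℕ => w'.1 (k + a) := by
    refine (StrictMono.range_inj (fun a b hab => lt_of_ascents h (by omega) (by omega))
      fun a b hab => lt_of_ascents h' (by omega) (by omega)).1 ?_
    have : ∀ v : SInf, Set.range (fun a : ℕ => v.1 (k + a)) = (firstValues k v : Set ℕ)ᶜ :=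
      fun v => by
      ext x
      simp only [Set.mem_range, Set.mem_compl_iff, Finset.mem_coe, mem_firstValues, not_exists,
        not_and]
      constructor
      · rintro ⟨a, rfl⟩ b hb e
        have := v.1.injective e
        omega
      · intro hx
        obtain ⟨b, hb⟩ := exists_apply_eq v x
        have hkb : k ≤ b := not_lt.1 fun hlt => hx b hlt hb
        exact ⟨b - k, by rw [Nat.add_sub_cancel' hkb, hb]⟩
    rw [this, this, he]
  refine SInf.ext_apply fun i => ?_
  rcases Nat.lt_or_ge i k with hi | hi
  · exact congrFun hl ⟨i, hi⟩
  · have := congrFun hr (i - k)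
    simpa only [Nat.add_sub_cancel' hi] using this

theorem coef_eq_of_firstValues_eq {k : ℕ} {g : Poly} (hg : IsSymmetricIn k g)
    {u w u' w' : SInf} (h : BlockLE k u w) (h' : BlockLE k u' w') (hz : w * u⁻¹ = w' * u'⁻¹)
    (he : firstValues k w = firstValues k w') :
    coef w (schubert u * g) = coef w' (schubert u' * g) := by
  obtain ⟨s, h1, h2, h3⟩ := h.exists_sort hg
  obtain ⟨s', h1', h2', h3'⟩ := h'.exists_sort hg
  have hw : w * s = w' * s' := eq_of_ascents h1 h1' (by rw [h2, h2', he])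
  have hu : u * s = u' * s' := by
    have e : w * u⁻¹ * (u * s) = w' * u'⁻¹ * (u' * s') := by
      rw [mul_assoc, inv_mul_cancel_left, mul_assoc, inv_mul_cancel_left, hw]
    rw [hz] at e
    exact mul_left_cancel e
  rw [← h3, ← h3', hw, hu]

/-- A letter in the first block of `w'` and in the second block of `w` is fixed by
`w u⁻¹ = w' u'⁻¹`: this permutation can neither raise nor lower it. -/
theorem BlockLE.exists_common_entry {k k' : ℕ} {u w u' w' : SInf} (h : BlockLE k u w)
    (h' : BlockLE k' u' w') (hz : w * u⁻¹ = w' * u'⁻¹) {x : ℕ} (hx' : x ∈ firstValues k' w')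
    (hx : x ∉ firstValues k w) : ∃ j, k ≤ j ∧ w.1 j = x ∧ w.1 j = u.1 j := by
  obtain ⟨a, ha, hax⟩ := mem_firstValues.1 hx'
  obtain ⟨j, hj⟩ := exists_apply_eq w x
  have hkj : k ≤ j := not_lt.1 fun hlt => hx (mem_firstValues.2 ⟨j, hlt, hj⟩)
  have h1 := h'.le_left a ha
  have h2 := h.le_right j hkj
  have e1 : (w * u⁻¹).1 (u.1 j) = w.1 j := by
    rw [← mul_val_apply, inv_mul_cancel_right]
  have e2 : (w' * u'⁻¹).1 (u'.1 a) = w'.1 a := by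
    rw [← mul_val_apply, inv_mul_cancel_right]
  rw [hz, hj, ← hax, ← e2] at e1
  have := (w' * u'⁻¹).1.injective e1
  exact ⟨j, hkj, hj, by omega⟩

/-- For a family of polynomials `g k`, symmetric in `x₁, …, x_k` and compatible with setting the
first variable to `0`, the coefficient of `𝔖_w` in `𝔖_u g_k` depends only on `w u⁻¹`. -/
theorem coef_eq_of_mul_inv_eq {g : ℕ → Poly} {K : ℕ}
    (hsym : ∀ k, K ≤ k → IsSymmetricIn k (g k)) (hdrop : ∀ k, K ≤ k → dropVar (g (k + 1)) = g k)
    {k k' : ℕ} (hk : K ≤ k) (hk' : K ≤ k') {u w u' w' : SInf} (h : BlockLE k u w)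
    (h' : BlockLE k' u' w') (hz : w * u⁻¹ = w' * u'⁻¹) :
    coef w (schubert u * g k) = coef w' (schubert u' * g k') := by
  induction hm : (firstValues k' w' \ firstValues k w).card +
    (firstValues k w \ firstValues k' w').card using Nat.strong_induction_on
    generalizing k k' u w u' w' with
  | _ m ih =>
  subst hm
  have step : ∀ {A B : Finset ℕ} {x : ℕ}, x ∈ B → x ∉ A →
      (B \ insert x A).card + (insert x A \ B).card < (B \ A).card + (A \ B).card := by
    intro A B x hB hA
    have e1 : B \ insert x A ⊂ B \ A := by
      refine Finset.ssubset_iff_subset_ne.2 ⟨fun y => by simp; tauto, fun e => ?_⟩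
      have : x ∈ B \ insert x A := by rw [e]; simp [hA, hB]
      simp at this
    have e2 : insert x A \ B = A \ B := by
      ext y
      simp only [Finset.mem_sdiff, Finset.mem_insert]
      grind
    rw [e2]
    exact Nat.add_lt_add_right (Finset.card_lt_card e1) _
  by_cases h1 : ∃ x, x ∈ firstValues k' w' ∧ x ∉ firstValues k w
  · obtain ⟨x, hx', hx⟩ := h1
    obtain ⟨j, hkj, rfl, hju⟩ := h.exists_common_entry h' hz hx' hx
    obtain ⟨s, s1, s2, s3⟩ := h.exists_enlarge (g := g (k + 1))
      (by rw [hdrop k hk]; exact hsym k hk) hkj hju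
    rw [hdrop k hk] at s3
    rw [← s3]
    refine ih _ ?_ (by omega) hk' s1 h' (by rw [mul_inv_rev, mul_assoc, mul_inv_cancel_left, hz])
      rfl
    rw [s2]
    exact step hx' hx
  by_cases h2 : ∃ x, x ∈ firstValues k w ∧ x ∉ firstValues k' w'
  · obtain ⟨x, hx, hx'⟩ := h2
    obtain ⟨j, hkj, rfl, hju⟩ := h'.exists_common_entry h hz.symm hx hx'
    obtain ⟨s, s1, s2, s3⟩ := h'.exists_enlarge (g := g (k' + 1))
      (by rw [hdrop k' hk']; exact hsym k' hk') hkj hju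
    rw [hdrop k' hk'] at s3
    rw [← s3]
    refine ih _ ?_ hk (by omega) h s1 (by rw [mul_inv_rev, mul_assoc, mul_inv_cancel_left, hz])
      rfl
    rw [s2, add_comm, add_comm (firstValues k' w' \ firstValues k w).card]
    exact step hx hx'
  push Not at h1 h2
  have he : firstValues k w = firstValues k' w' := Finset.Subset.antisymm h2 h1
  obtain rfl : k = k' := by rw [← card_firstValues k w, he, card_firstValues]
  exact coef_eq_of_firstValues_eq (hsym k hk) h h' hz he

/-! ### Schubert polynomials of Grassmannian permutations -/

theorem grassmannian_apply (lam : YoungDiagram) (k : ℕ) (hk : lam.colLen 0 ≤ k) (i : ℕ) :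
    (grassmannian lam k hk).1 i = grassmannianFun lam k i := rfl

theorem isSymmetricIn_schubert_grassmannian (lam : YoungDiagram) (k : ℕ)
    (hk : lam.colLen 0 ≤ k) : IsSymmetricIn k (schubert (grassmannian lam k hk)) := by
  intro i hi
  refine divDiff_schubert_of_ascent ?_
  rw [grassmannian_apply, grassmannian_apply]
  rcases Nat.lt_or_ge (i + 1) k with h | h
  · exact grassmannianFun_strictMono_left lam k (Nat.lt_succ_self i) h
  · exact grassmannianFun_strictMono_right lam k hk (Nat.lt_succ_self i) (by omega)

theorem shift_grassmannian (lam : YoungDiagram) (k : ℕ) (hk : lam.colLen 0 ≤ k) :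
    shift (grassmannian lam k hk) = grassmannian lam (k + 1) (hk.trans (Nat.le_succ k)) := by
  refine SInf.ext_apply fun i => ?_
  cases i with
  | zero =>
    have h1 := YoungDiagram.mem_iff_lt_rowLen (μ := lam) (i := k) (j := 0)
    have h2 := YoungDiagram.mem_iff_lt_colLen (μ := lam) (i := k) (j := 0)
    have h3 := h1.symm.trans h2
    rw [shift_zero, grassmannian_apply, grassmannianFun, if_pos (Nat.succ_pos k),
      show k + 1 - 1 - 0 = k by omega]
    omega
  | succ i =>
    rw [shift_succ, grassmannian_apply, grassmannian_apply, grassmannianFun, grassmannianFun]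
    have h0 := lam.colLen_anti _ _ (Nat.zero_le (i - k))
    by_cases hi : i < k
    · rw [if_pos hi, if_pos (by omega), show k + 1 - 1 - (i + 1) = k - 1 - i by omega]
      omega
    · rw [if_neg hi, if_neg (by omega), show i + 1 - (k + 1) = i - k by omega]
      omega

open Classical in
/-- The Schur polynomial `S_λ(x₁, …, x_k)` as the Schubert polynomial of `v(λ, k)`; the value `0`
for small `k` is irrelevant. -/
noncomputable def grassmannianPoly (lam : YoungDiagram) (k : ℕ) : Poly :=
  if hk : lam.colLen 0 ≤ k then schubert (grassmannian lam k hk) else 0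

theorem grassmannianPoly_eq (lam : YoungDiagram) {k : ℕ} (hk : lam.colLen 0 ≤ k) :
    grassmannianPoly lam k = schubert (grassmannian lam k hk) := dif_pos hk

theorem dropVar_grassmannianPoly (lam : YoungDiagram) {k : ℕ} (hk : lam.colLen 0 ≤ k) :
    dropVar (grassmannianPoly lam (k + 1)) = grassmannianPoly lam k := by
  rw [grassmannianPoly_eq lam hk, grassmannianPoly_eq lam (hk.trans (Nat.le_succ k)),
    ← shift_grassmannian, dropVar_schubert_shift]

end SchubertStructure

theorem mainTheorem5 :
    -- the constants `c_{u v(λ,k)}^w` are well defined by the expansion of the product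
    (∀ (lam : YoungDiagram) (k : ℕ) (hk : lam.colLen 0 ≤ k) (u : SchubertStructure.SInf),
      SchubertStructure.IsSchubertExpansion
        (SchubertStructure.schubert u *
          SchubertStructure.schubert (SchubertStructure.grassmannian lam k hk))
        (SchubertStructure.structureConst u (SchubertStructure.grassmannian lam k hk)) ∧
      ∀ c : SchubertStructure.SInf →₀ ℤ,
        SchubertStructure.IsSchubertExpansion
          (SchubertStructure.schubert u *
            SchubertStructure.schubert (SchubertStructure.grassmannian lam k hk)) c →
        c = SchubertStructure.structureConst u (SchubertStructure.grassmannian lam k hk)) ∧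
    -- (1)
    (∀ (lam : YoungDiagram) (k : ℕ) (hk : lam.colLen 0 ≤ k) (u w : SchubertStructure.SInf),
      ¬ SchubertStructure.KBruhatLE k u w →
      SchubertStructure.structureConst u (SchubertStructure.grassmannian lam k hk) w = 0) ∧
    -- (2)
    (∀ (lam : YoungDiagram) (k k' : ℕ) (hk : lam.colLen 0 ≤ k) (hk' : lam.colLen 0 ≤ k')
      (u w u' w' : SchubertStructure.SInf),
      SchubertStructure.KBruhatLE k u w → SchubertStructure.KBruhatLE k' u' w' →
      w * u⁻¹ = w' * u'⁻¹ →
      SchubertStructure.structureConst u (SchubertStructure.grassmannian lam k hk) w =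
        SchubertStructure.structureConst u' (SchubertStructure.grassmannian lam k' hk') w') := by
  refine ⟨fun lam k hk u => ⟨?_, fun c hc => ?_⟩, fun lam k hk u w h => ?_,
    fun lam k k' hk hk' u w u' w' h h' hz => ?_⟩
  · rw [SchubertStructure.isSchubertExpansion_iff, SchubertStructure.structureConst_eq_repr]
  · rw [SchubertStructure.structureConst_eq_repr]
    exact (SchubertStructure.isSchubertExpansion_iff _ _).1 hc
  · rw [SchubertStructure.structureConst_apply]
    by_contra hne
    exact h (SchubertStructure.blockLE_of_coef_mul_ne_zero
      (SchubertStructure.isSymmetricIn_schubert_grassmannian lam k hk) hne).kBruhatLE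
  · rw [SchubertStructure.structureConst_apply, SchubertStructure.structureConst_apply,
      ← SchubertStructure.grassmannianPoly_eq lam hk,
      ← SchubertStructure.grassmannianPoly_eq lam hk']
    refine SchubertStructure.coef_eq_of_mul_inv_eq (K := lam.colLen 0) (fun k hk => ?_)
      (fun k hk => SchubertStructure.dropVar_grassmannianPoly lam hk) hk hk'
      (SchubertStructure.blockLE_of_kBruhatLE h) (SchubertStructure.blockLE_of_kBruhatLE h') hz
    rw [SchubertStructure.grassmannianPoly_eq lam hk]
    exact SchubertStructure.isSymmetricIn_schubert_grassmannian lam k hk
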